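/- Let $V$ be a finite dimensional complex vector space with a fixed basis; identify operators on tensor powers of $V$ with matrices, and write $X_m$ for $X\in \mathrm{End}(V^{\otimes 2})$ acting in the spaces $m,m+1$. An R-matrix is an invertible $R\in\mathrm{End}(V^{\otimes 2})$ with $R_1R_2R_1=R_2R_1R_2$. An operator $X$ is skew invertible if there is $\Psi_X$ with $\mathrm{Tr}_{(2)}X_{12}(\Psi_X)_{23}=\mathrm{Tr}_{(2)}(\Psi_X)_{12}X_{23}=P_{13}$ ($P$ the permutation); put $C_X=\mathrm{Tr}_{(1)}(\Psi_X)_{12}$, $D_X=\mathrm{Tr}_{(2)}(\Psi_X)_{12}$; $X$ is strict skew invertible if moreover $C_X$ or $D_X$ is invertible. A pair $\{R,F\}$ is compatible if $R_1F_2F_1=F_2F_1R_2$ and $R_2F_1F_2=F_1F_2R_1$. For $q\in\mathbb C\setminus\{0,\pm1\}$, $\mu\in\mathbb C\setminus\{0,q,-q^{-1}\}$, an R-matrix $R$ is of BMW type if its minimal polynomial is $(x-q)(x+q^{-1})(x-\mu)$ and $K:=\mu^{-1}(q-q^{-1})^{-1}(qI-R)(q^{-1}I+R)$ satisfies $K_2K_1=R_1^{\pm1}R_2^{\pm1}K_1$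 (equal signs) and $K_1K_2K_1=K_1$. Write $\mathrm{Tr}_R(\,\cdot\,)=\mathrm{Tr}(D_R\,\cdot\,)$. Let $\{R,F\}$ be a compatible pair of strict skew invertible R-matrices with $R$ of BMW type. The quantum matrix algebra $\mathcal M(R,F)$ is the unital associative $\mathbb C$-algebra generated by the entries $M_a^b$ of a matrix $M$ subject to $R_1M_{\overline 1}M_{\overline 2}=M_{\overline 1}M_{\overline 2}R_1$, where $M_{\overline 1}=M_1$, $M_{\overline 2}=F_{1}M_1F_{1}^{-1}$. Put $$\eta=\frac{(q-\mu)(q^{-1}+\mu)}{\mu(q-q^{-1})},\quad g=\eta^{-1}\,\mathrm{Tr}_{R(1,2)}(M_{\overline1}M_{\overline2}K_1),\quad G_1=\mathrm{Tr}_{(23)}K_2F_1^{-1}F_2^{-1},\quad \xi(M)_1=\mathrm{Tr}_{R(2)}(F_{12}M_1F_{12}^{-1}K_{12}).$$ Let $\mathcal M^{\bullet}(R,F)$ be the extension of $\mathcal M(R,F)$ by a generator $g^{-1}$ subject to $$g^{-1}g=g\,g^{-1}=1,\qquad g^{-1}M=(G^{-1}MG)\,g^{-1}.$$ Then: 1.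 $G$ is invertible, and $Mg=g\,(G^{-1}MG)$ holds in $\mathcal M(R,F)$. 2. The extension is consistent: $\mathcal M^{\bullet}(R,F)\neq0$, the image of $g$ under the canonical map $\mathcal M(R,F)\to\mathcal M^{\bullet}(R,F)$ has the two-sided inverse $g^{-1}$, and every algebra homomorphism from $\mathcal M(R,F)$ to a $\mathbb C$-algebra $B$ that sends $g$ to an invertible element factors uniquely through this canonical map. 3. Over $\mathcal M^{\bullet}(R,F)$ the matrix $M^{-1}:=\mu\,\xi(M)\,g^{-1}$ is a two-sided inverse of $M$: $M\cdot M^{-1}=M^{-1}\cdot M=I$. -/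

import Mathlib

universe u v

open scoped BigOperators

namespace QuantumMatrix

section Legs

variable {ι : Type u} [Fintype ι] [DecidableEq ι]

/-! Fix a basis of `V` indexed by `ι`. An operator on `V`, `V ⊗ V`, `V ⊗ V ⊗ V` is a matrix indexed by
`ι`, `ι × ι`, `ι × ι × ι`; entries lie in `ℂ` or in a `ℂ`-algebra. Rows are the lower indices,
columns the upper ones. -/

/-- `X₁₂`, an operator on `V ⊗ V ⊗ V`. -/
def leg12 {A : Type*} [Zero A] (X : Matrix (ι × ι) (ι × ι) A) :
    Matrix (ι × ι × ι) (ι × ι × ι) A :=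
  fun i j => if i.2.2 = j.2.2 then X (i.1, i.2.1) (j.1, j.2.1) else 0

/-- `X₂₃`, an operator on `V ⊗ V ⊗ V`. -/
def leg23 {A : Type*} [Zero A] (X : Matrix (ι × ι) (ι × ι) A) :
    Matrix (ι × ι × ι) (ι × ι × ι) A :=
  fun i j => if i.1 = j.1 then X i.2 j.2 else 0

/-- `M₁ = M ⊗ I`, an operator on `V ⊗ V`. -/
def leg1 {A : Type*} [Zero A] (M : Matrix ι ι A) : Matrix (ι × ι) (ι × ι) A :=
  fun i j => if i.2 = j.2 then M i.1 j.1 else 0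

/-- `M₂ = I ⊗ M`, an operator on `V ⊗ V`. -/
def leg2 {A : Type*} [Zero A] (M : Matrix ι ι A) : Matrix (ι × ι) (ι × ι) A :=
  fun i j => if i.1 = j.1 then M i.2 j.2 else 0

/-- `Tr₍₁₎` on `V ⊗ V`. -/
def tr1 {A : Type*} [AddCommMonoid A] (X : Matrix (ι × ι) (ι × ι) A) : Matrix ι ι A :=
  fun a b => ∑ k, X (k, a) (k, b)

/-- `Tr₍₂₎` on `V ⊗ V`. -/
def tr2 {A : Type*} [AddCommMonoid A] (X : Matrix (ι × ι) (ι × ι) A) : Matrix ι ι A :=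
  fun a b => ∑ k, X (a, k) (b, k)

/-- `Tr₍₂₎` on `V ⊗ V ⊗ V`; the result acts on the spaces 1 and 3. -/
def trMiddle {A : Type*} [AddCommMonoid A] (X : Matrix (ι × ι × ι) (ι × ι × ι) A) :
    Matrix (ι × ι) (ι × ι) A :=
  fun a b => ∑ k, X (a.1, k, a.2) (b.1, k, b.2)

/-- `Tr₍₂₃₎` on `V ⊗ V ⊗ V`. -/
def tr23 {A : Type*} [AddCommMonoid A] (X : Matrix (ι × ι × ι) (ι × ι × ι) A) : Matrix ι ι A :=
  fun a b => ∑ k : ι × ι, X (a, k) (b, k)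

variable (ι) in
/-- The permutation operator `P (u ⊗ v) = v ⊗ u`. -/
def permOp : Matrix (ι × ι) (ι × ι) ℂ :=
  fun i j => if i.1 = j.2 ∧ i.2 = j.1 then 1 else 0

/-- A complex matrix regarded as a matrix over a `ℂ`-algebra `A`. -/
def lift (A : Type*) [Semiring A] [Algebra ℂ A] {κ : Type*} (X : Matrix κ κ ℂ) : Matrix κ κ A :=
  X.map (algebraMap ℂ A)

end Legs

noncomputable section RMatrices

variable {ι : Type u} [Fintype ι] [DecidableEq ι]

/-- `Ψ` is a skew inverse of `X`: `Tr₍₂₎ X₁₂ Ψ₂₃ = Tr₍₂₎ Ψ₁₂ X₂₃ = P₁₃`. -/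
def IsSkewInverse (X Ψ : Matrix (ι × ι) (ι × ι) ℂ) : Prop :=
  trMiddle (leg12 X * leg23 Ψ) = permOp ι ∧ trMiddle (leg12 Ψ * leg23 X) = permOp ι

def SkewInvertible (X : Matrix (ι × ι) (ι × ι) ℂ) : Prop :=
  ∃ Ψ, IsSkewInverse X Ψ

open Classical in
/-- The (unique) skew inverse of a skew invertible operator; zero by convention otherwise. -/
def skewInverse (X : Matrix (ι × ι) (ι × ι) ℂ) : Matrix (ι × ι) (ι × ι) ℂ :=
  if h : SkewInvertible X then h.choose else 0

def matC (X : Matrix (ι × ι) (ι × ι) ℂ) : Matrix ι ι ℂ := tr1 (skewInverse X)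

def matD (X : Matrix (ι × ι) (ι × ι) ℂ) : Matrix ι ι ℂ := tr2 (skewInverse X)

def StrictSkewInvertible (X : Matrix (ι × ι) (ι × ι) ℂ) : Prop :=
  SkewInvertible X ∧ (IsUnit (matC X) ∨ IsUnit (matD X))

/-- An R-matrix: an invertible solution of the Yang-Baxter equation. -/
def IsRMatrix (R : Matrix (ι × ι) (ι × ι) ℂ) : Prop :=
  IsUnit R ∧ leg12 R * leg23 R * leg12 R = leg23 R * leg12 R * leg23 R

/-- The twist relations for a pair `{R, F}`. -/
def CompatiblePair (R F : Matrix (ι × ι) (ι × ι) ℂ) : Prop :=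
  leg12 R * leg23 F * leg12 F = leg23 F * leg12 F * leg23 R ∧
  leg23 R * leg12 F * leg23 F = leg12 F * leg23 F * leg12 R

/-- `K = μ⁻¹ (q - q⁻¹)⁻¹ (q I - R) (q⁻¹ I + R)`. -/
def opK (q μ : ℂ) (R : Matrix (ι × ι) (ι × ι) ℂ) : Matrix (ι × ι) (ι × ι) ℂ :=
  (μ⁻¹ * (q - q⁻¹)⁻¹) • ((q • 1 - R) * (q⁻¹ • 1 + R))

open Polynomial in
/-- R-matrices of the BMW type with parameters `q`, `μ`. -/
structure IsBMWType (q μ : ℂ) (R : Matrix (ι × ι) (ι × ι) ℂ) : Prop where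
  isRMatrix : IsRMatrix R
  q_ne_zero : q ≠ 0
  q_ne_one : q ≠ 1
  q_ne_neg_one : q ≠ -1
  mu_ne_zero : μ ≠ 0
  mu_ne_q : μ ≠ q
  mu_ne_neg_q_inv : μ ≠ -q⁻¹
  minpoly_eq : minpoly ℂ R = (X - C q) * (X + C q⁻¹) * (X - C μ)
  K_mul_K : leg23 (opK q μ R) * leg12 (opK q μ R) = leg12 R * leg23 R * leg12 (opK q μ R)
  K_mul_K' : leg23 (opK q μ R) * leg12 (opK q μ R) = leg12 R⁻¹ * leg23 R⁻¹ * leg12 (opK q μ R)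
  K_mul_K_mul_K :
    leg12 (opK q μ R) * leg23 (opK q μ R) * leg12 (opK q μ R) = leg12 (opK q μ R)

/-- `G₁ = Tr₍₂₃₎ K₂ F₁⁻¹ F₂⁻¹`. -/
def opG (q μ : ℂ) (R F : Matrix (ι × ι) (ι × ι) ℂ) : Matrix ι ι ℂ :=
  tr23 (leg23 (opK q μ R) * leg12 F⁻¹ * leg23 F⁻¹)

/-- `η = (q - μ) (q⁻¹ + μ) / (μ (q - q⁻¹))`. -/
def eta (q μ : ℂ) : ℂ := (q - μ) * (q⁻¹ + μ) / (μ * (q - q⁻¹))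

end RMatrices

noncomputable section MatricesOverAlgebras

variable {ι : Type u} [Fintype ι] [DecidableEq ι] {A : Type*} [Semiring A] [Algebra ℂ A]

/-- The second copy `F M₁ F⁻¹` of a matrix `M` (the first copy is `M₁`). -/
def copy2 (F : Matrix (ι × ι) (ι × ι) ℂ) (M : Matrix ι ι A) : Matrix (ι × ι) (ι × ι) A :=
  lift A F * leg1 M * lift A F⁻¹

/-- Left side of the quantum matrix relation: `R` times the first and the second copy of `M`. -/
def relLeft (R F : Matrix (ι × ι) (ι × ι) ℂ) (M : Matrix ι ι A) : Matrix (ι × ι) (ι × ι) A :=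
  lift A R * leg1 M * copy2 F M

/-- Right side of the quantum matrix relation: the two copies of `M` times `R`. -/
def relRight (R F : Matrix (ι × ι) (ι × ι) ℂ) (M : Matrix ι ι A) : Matrix (ι × ι) (ι × ι) A :=
  leg1 M * copy2 F M * lift A R

/-- The R-trace over the second space, `Tr₍₂₎ (D_R)₂ X₁₂`. -/
def rTr2 (R : Matrix (ι × ι) (ι × ι) ℂ) (X : Matrix (ι × ι) (ι × ι) A) : Matrix ι ι A :=
  tr2 (lift A (leg2 (matD R)) * X)

/-- The R-trace over both spaces, `Tr₍₁₂₎ (D_R)₁ (D_R)₂ X₁₂`. -/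
def rTr12 (R : Matrix (ι × ι) (ι × ι) ℂ) (X : Matrix (ι × ι) (ι × ι) A) : A :=
  Matrix.trace (lift A (leg1 (matD R) * leg2 (matD R)) * X)

/-- The linear map `ξ(M)₁ = Tr_R₍₂₎ (F₁₂ M₁ F₁₂⁻¹ K₁₂)`. -/
def xi (q μ : ℂ) (R F : Matrix (ι × ι) (ι × ι) ℂ) (M : Matrix ι ι A) : Matrix ι ι A :=
  rTr2 R (lift A F * leg1 M * lift A F⁻¹ * lift A (opK q μ R))

/-- The 2-contraction of `M`: `η⁻¹` times the R-trace over both spaces of the product of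
the two copies of `M` and `K`. -/
def contraction (q μ : ℂ) (R F : Matrix (ι × ι) (ι × ι) ℂ) (M : Matrix ι ι A) : A :=
  (eta q μ)⁻¹ • rTr12 R (leg1 M * copy2 F M * lift A (opK q μ R))

/-- `G⁻¹ M G`. -/
def conjG (q μ : ℂ) (R F : Matrix (ι × ι) (ι × ι) ℂ) (M : Matrix ι ι A) : Matrix ι ι A :=
  lift A (opG q μ R F)⁻¹ * M * lift A (opG q μ R F)

end MatricesOverAlgebras

noncomputable section Algebras

variable {ι : Type u} [Fintype ι] [DecidableEq ι]

variable (ι) in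
/-- The matrix of free generators `M_a^b`. -/
def freeM : Matrix ι ι (FreeAlgebra ℂ (ι × ι)) := fun a b => FreeAlgebra.ι ℂ (a, b)

/-- The entries of the quantum matrix relation. -/
inductive QMRel (R F : Matrix (ι × ι) (ι × ι) ℂ) :
    FreeAlgebra ℂ (ι × ι) → FreeAlgebra ℂ (ι × ι) → Prop
  | rmm (i j : ι × ι) : QMRel R F (relLeft R F (freeM ι) i j) (relRight R F (freeM ι) i j)

/-- The quantum matrix algebra `M(R, F)`. -/
abbrev QMAlgebra (R F : Matrix (ι × ι) (ι × ι) ℂ) : Type u := RingQuot (QMRel R F)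

/-- The matrix of generators of `M(R, F)`. -/
def genM (R F : Matrix (ι × ι) (ι × ι) ℂ) : Matrix ι ι (QMAlgebra R F) :=
  (freeM ι).map (RingQuot.mkAlgHom ℂ (QMRel R F))

variable (ι) in
/-- The free generators `M_a^b` in the free algebra with one more generator. -/
def freeExtM : Matrix ι ι (FreeAlgebra ℂ (Option (ι × ι))) :=
  fun a b => FreeAlgebra.ι ℂ (some (a, b))

variable (ι) in
/-- The additional free generator, which becomes `g⁻¹`. -/
def freeExtInv : FreeAlgebra ℂ (Option (ι × ι)) := FreeAlgebra.ι ℂ none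

/-- The quantum matrix relation, together with `g⁻¹ g = g g⁻¹ = 1` and
`g⁻¹ M = (G⁻¹ M G) g⁻¹`. -/
inductive ExtRel (q μ : ℂ) (R F : Matrix (ι × ι) (ι × ι) ℂ) :
    FreeAlgebra ℂ (Option (ι × ι)) → FreeAlgebra ℂ (Option (ι × ι)) → Prop
  | rmm (i j : ι × ι) :
      ExtRel q μ R F (relLeft R F (freeExtM ι) i j) (relRight R F (freeExtM ι) i j)
  | inv_mul : ExtRel q μ R F (freeExtInv ι * contraction q μ R F (freeExtM ι)) 1
  | mul_inv : ExtRel q μ R F (contraction q μ R F (freeExtM ι) * freeExtInv ι) 1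
  | comm (a b : ι) :
      ExtRel q μ R F (freeExtInv ι * freeExtM ι a b)
        (conjG q μ R F (freeExtM ι) a b * freeExtInv ι)

/-- The algebra `M(R, F)` extended by the generator `g⁻¹`. -/
abbrev ExtAlgebra (q μ : ℂ) (R F : Matrix (ι × ι) (ι × ι) ℂ) : Type u :=
  RingQuot (ExtRel q μ R F)

/-- The matrix `M` of generators in the extended algebra. -/
def extM (q μ : ℂ) (R F : Matrix (ι × ι) (ι × ι) ℂ) : Matrix ι ι (ExtAlgebra q μ R F) :=
  (freeExtM ι).map (RingQuot.mkAlgHom ℂ (ExtRel q μ R F))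

/-- The generator `g⁻¹` of the extended algebra. -/
def extInv (q μ : ℂ) (R F : Matrix (ι × ι) (ι × ι) ℂ) : ExtAlgebra q μ R F :=
  RingQuot.mkAlgHom ℂ (ExtRel q μ R F) (freeExtInv ι)

/-- The matrix `M⁻¹ := μ ξ(M) g⁻¹` over the extended algebra. -/
def extMInv (q μ : ℂ) (R F : Matrix (ι × ι) (ι × ι) ℂ) : Matrix ι ι (ExtAlgebra q μ R F) :=
  fun a b => μ • (xi q μ R F (extM q μ R F) a b * extInv q μ R F)

section Maps

variable {A B : Type*} [Semiring A] [Algebra ℂ A] [Semiring B] [Algebra ℂ B] (f : A →ₐ[ℂ] B)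

theorem lift_map {κ : Type*} (X : Matrix κ κ ℂ) : (lift A X).map f = lift B X := by
  ext i j
  simp [lift]

theorem leg1_map (M : Matrix ι ι A) : (leg1 M).map f = leg1 (M.map f) := by
  ext i j
  simp only [leg1, Matrix.map_apply]
  split_ifs <;> simp

theorem copy2_map (F : Matrix (ι × ι) (ι × ι) ℂ) (M : Matrix ι ι A) :
    (copy2 F M).map f = copy2 F (M.map f) := by
  simp only [copy2, Matrix.map_mul, lift_map, leg1_map]

theorem relLeft_map (R F : Matrix (ι × ι) (ι × ι) ℂ) (M : Matrix ι ι A) :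
    (relLeft R F M).map f = relLeft R F (M.map f) := by
  simp only [relLeft, Matrix.map_mul, lift_map, leg1_map, copy2_map]

theorem relRight_map (R F : Matrix (ι × ι) (ι × ι) ℂ) (M : Matrix ι ι A) :
    (relRight R F M).map f = relRight R F (M.map f) := by
  simp only [relRight, Matrix.map_mul, lift_map, leg1_map, copy2_map]

end Maps

theorem extM_rel (q μ : ℂ) (R F : Matrix (ι × ι) (ι × ι) ℂ) :
    relLeft R F (extM q μ R F) = relRight R F (extM q μ R F) := by
  rw [extM, ← relLeft_map, ← relRight_map]
  ext i j
  exact RingQuot.mkAlgHom_rel ℂ (ExtRel.rmm i j)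

theorem freeM_map_lift (q μ : ℂ) (R F : Matrix (ι × ι) (ι × ι) ℂ) :
    (freeM ι).map (FreeAlgebra.lift ℂ fun p : ι × ι => extM q μ R F p.1 p.2) = extM q μ R F := by
  ext a b
  simp [freeM]

/-- The canonical homomorphism from `M(R, F)` to the extended algebra, `M_a^b ↦ M_a^b`. -/
def toExt (q μ : ℂ) (R F : Matrix (ι × ι) (ι × ι) ℂ) :
    QMAlgebra R F →ₐ[ℂ] ExtAlgebra q μ R F :=
  RingQuot.liftAlgHom ℂ
    ⟨FreeAlgebra.lift ℂ fun p : ι × ι => extM q μ R F p.1 p.2, by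
      rintro _ _ ⟨i, j⟩
      have hl := congrFun (congrFun (relLeft_map
        (FreeAlgebra.lift ℂ fun p : ι × ι => extM q μ R F p.1 p.2) R F (freeM ι)) i) j
      have hr := congrFun (congrFun (relRight_map
        (FreeAlgebra.lift ℂ fun p : ι × ι => extM q μ R F p.1 p.2) R F (freeM ι)) i) j
      rw [freeM_map_lift] at hl hr
      exact hl.trans ((congrFun (congrFun (extM_rel q μ R F) i) j).trans hr.symm)⟩

end Algebras

end QuantumMatrix

set_option linter.unusedSectionVars false
set_option linter.unusedSimpArgs false

/-! The heart of the matter is that $K$ has rank one. Two applications of the skew inverse of $R$ to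
$K_2K_1=R_1R_2K_1$ remove both factors $R$ and show that $K=u\otimes w$ with $u$ nondegenerate
(`exists_flip_factor`, `exists_eq_outer`). The relations $K_2K_1K_2=K_2$ and $K_2R_1K_2=\mu^{-1}K_2$
then become statements about $u$ and $w$: $w$ is nondegenerate too, and $D_R=\mu\,uw^{T}$
(`IsBMWType.exists_isPairing`). From here on $u$ is a cup and $w$ a cap.

Since $K$ is a polynomial in $R$, it inherits every intertwining relation of $R$. Compatibility of
$\{R,F\}$ lets the cap and the cup pass through two crossings $F$ up to invertible matrices, so $G$
is a product of invertible matrices. The quantum matrix relation makes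
$M_{\overline1}M_{\overline2}$ commute with $K$, so by rank one this product acts on the cup and on
the cap as one element of the algebra, equal to $\mu^{-2}g$ (`IsPairing.exists_contraction_eq`).

Evaluating $M_{\overline1}M_{\overline2}M_{\overline3}$ between a cap on spaces 1, 2 and a cup on
spaces 2, 3 in two ways gives $Mg=g\,(G^{-1}MG)$ (`IsPairing.mul_contraction`). This yields the
universal property; the extension is nonzero because $M=I$ defines a homomorphism to $\mathbb C$
with $g=\mu^2$.

Taking the R-trace over space 2 gives $M\,\xi(M)=\mu^{-1}g$, hence a right inverse. The product
$\xi(M)M$ is never computed: capping $M_1FM_1$ with $w$ produces some left inverse of $M$, once the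
covector $wF$ is known to be nondegenerate (`isUnit_compOp`), and a left inverse must equal the
right one. -/

namespace QuantumMatrix

/-! ### Index calculus for legs, cups and caps on three tensor factors. -/

section LegCalculus

variable {ι : Type u} [Fintype ι] [DecidableEq ι]

/-- The covector `w` applied to the spaces 1, 2 of `V ⊗ V ⊗ V`. -/
def cap12 {A : Type*} [Zero A] (w : Matrix ι ι A) : Matrix ι (ι × ι × ι) A :=
  fun c x => if c = x.2.2 then w x.1 x.2.1 else 0

/-- The covector `w` applied to the spaces 2, 3 of `V ⊗ V ⊗ V`. -/
def cap23 {A : Type*} [Zero A] (w : Matrix ι ι A) : Matrix ι (ι × ι × ι) A :=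
  fun a x => if a = x.1 then w x.2.1 x.2.2 else 0

/-- The vector `u` inserted in the spaces 1, 2 of `V ⊗ V ⊗ V`. -/
def cup12 {A : Type*} [Zero A] (u : Matrix ι ι A) : Matrix (ι × ι × ι) ι A :=
  fun x c => if x.2.2 = c then u x.1 x.2.1 else 0

/-- The vector `u` inserted in the spaces 2, 3 of `V ⊗ V ⊗ V`. -/
def cup23 {A : Type*} [Zero A] (u : Matrix ι ι A) : Matrix (ι × ι × ι) ι A :=
  fun x a => if x.1 = a then u x.2.1 x.2.2 else 0

/-- The rank one operator `u ⊗ w` on `V ⊗ V`. -/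
def outer {A : Type*} [Mul A] (u w : Matrix ι ι A) : Matrix (ι × ι) (ι × ι) A :=
  fun i j => u i.1 i.2 * w j.1 j.2

/-- The composition of a covector `w` on `V ⊗ V` with an operator. -/
def compOp {A : Type*} [NonUnitalNonAssocSemiring A] (w : Matrix ι ι A)
    (X : Matrix (ι × ι) (ι × ι) A) : Matrix ι ι A :=
  fun a b => ∑ k : ι × ι, w k.1 k.2 * X k (a, b)

section General

variable {A : Type*} [Semiring A]

theorem leg12_mul (X Y : Matrix (ι × ι) (ι × ι) A) : leg12 (X * Y) = leg12 X * leg12 Y := by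
  ext ⟨a, b, c⟩ ⟨d, e, f⟩
  simp [leg12, Matrix.mul_apply, Fintype.sum_prod_type, ite_mul, mul_ite]

theorem leg23_mul (X Y : Matrix (ι × ι) (ι × ι) A) : leg23 (X * Y) = leg23 X * leg23 Y := by
  ext ⟨a, b, c⟩ ⟨d, e, f⟩
  simp [leg23, Matrix.mul_apply, Fintype.sum_prod_type, ite_mul, mul_ite]

theorem leg12_one : leg12 (1 : Matrix (ι × ι) (ι × ι) A) = 1 := by
  ext ⟨a, b, c⟩ ⟨d, e, f⟩
  simp only [leg12, Matrix.one_apply, Prod.mk.injEq]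
  split_ifs <;> simp_all

theorem leg23_one : leg23 (1 : Matrix (ι × ι) (ι × ι) A) = 1 := by
  ext ⟨a, b, c⟩ ⟨d, e, f⟩
  simp only [leg23, Matrix.one_apply, Prod.mk.injEq]
  split_ifs <;> simp_all

theorem leg12_smul {S : Type*} [SMulZeroClass S A] (c : S) (X : Matrix (ι × ι) (ι × ι) A) :
    leg12 (c • X) = c • leg12 X := by
  ext i j
  simp only [leg12, Matrix.smul_apply]
  split_ifs <;> simp

theorem leg23_smul {S : Type*} [SMulZeroClass S A] (c : S) (X : Matrix (ι × ι) (ι × ι) A) :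
    leg23 (c • X) = c • leg23 X := by
  ext i j
  simp only [leg23, Matrix.smul_apply]
  split_ifs <;> simp

theorem leg12_add (X Y : Matrix (ι × ι) (ι × ι) A) : leg12 (X + Y) = leg12 X + leg12 Y := by
  ext i j
  simp only [leg12, Matrix.add_apply]
  split_ifs <;> simp

theorem leg23_add (X Y : Matrix (ι × ι) (ι × ι) A) : leg23 (X + Y) = leg23 X + leg23 Y := by
  ext i j
  simp only [leg23, Matrix.add_apply]
  split_ifs <;> simp

theorem leg12_sub {A : Type*} [Ring A] (X Y : Matrix (ι × ι) (ι × ι) A) :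
    leg12 (X - Y) = leg12 X - leg12 Y := by
  ext i j
  simp only [leg12, Matrix.sub_apply]
  split_ifs <;> simp

theorem leg23_sub {A : Type*} [Ring A] (X Y : Matrix (ι × ι) (ι × ι) A) :
    leg23 (X - Y) = leg23 X - leg23 Y := by
  ext i j
  simp only [leg23, Matrix.sub_apply]
  split_ifs <;> simp

theorem leg12_outer (u w : Matrix ι ι A) : leg12 (outer u w) = cup12 u * cap12 w := by
  ext ⟨a, b, c⟩ ⟨d, e, f⟩
  simp [leg12, outer, cup12, cap12, Matrix.mul_apply, ite_mul, mul_ite]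

theorem leg23_outer (u w : Matrix ι ι A) : leg23 (outer u w) = cup23 u * cap23 w := by
  ext ⟨a, b, c⟩ ⟨d, e, f⟩
  simp [leg23, outer, cup23, cap23, Matrix.mul_apply, ite_mul, mul_ite]

theorem cap12_mul_cup12 (w u : Matrix ι ι A) :
    cap12 w * cup12 u = (∑ k : ι × ι, w k.1 k.2 * u k.1 k.2) • (1 : Matrix ι ι A) := by
  ext a b
  simp only [cap12, cup12, Matrix.mul_apply, Fintype.sum_prod_type, ite_mul, mul_ite, zero_mul,
    mul_zero, Finset.sum_ite_eq, Finset.mem_univ, if_true, Matrix.smul_apply, Matrix.one_apply,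
    smul_eq_mul, mul_one]
  by_cases h : a = b <;> simp [h]

theorem cap23_mul_cup23 (w u : Matrix ι ι A) :
    cap23 w * cup23 u = (∑ k : ι × ι, w k.1 k.2 * u k.1 k.2) • (1 : Matrix ι ι A) := by
  ext a b
  simp [cap23, cup23, Matrix.mul_apply, Fintype.sum_prod_type, ite_mul, mul_ite,
    Matrix.one_apply]

/-- This and the next lemma are the two zigzags; the snake does not straighten to the identity but
to a matrix built from $u$ and $w$. -/
theorem cap23_mul_cup12 (w u : Matrix ι ι ℂ) : cap23 w * cup12 u = u * w := by
  ext a b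
  simp [cap23, cup12, Matrix.mul_apply, Fintype.sum_prod_type, ite_mul, mul_ite, mul_comm]

theorem cap12_mul_cup23 (w u : Matrix ι ι ℂ) : cap12 w * cup23 u = (w * u).transpose := by
  ext a b
  simp [cap12, cup23, Matrix.mul_apply, Fintype.sum_prod_type, ite_mul, mul_ite,
    Matrix.transpose_apply]

theorem cap12_compOp (w : Matrix ι ι A) (X : Matrix (ι × ι) (ι × ι) A) :
    cap12 (compOp w X) = cap12 w * leg12 X := by
  ext a ⟨b, c, d⟩
  simp [cap12, compOp, leg12, Matrix.mul_apply, Fintype.sum_prod_type, ite_mul, mul_ite]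

theorem cap23_compOp (w : Matrix ι ι A) (X : Matrix (ι × ι) (ι × ι) A) :
    cap23 (compOp w X) = cap23 w * leg23 X := by
  ext a ⟨b, c, d⟩
  simp [cap23, compOp, leg23, Matrix.mul_apply, Fintype.sum_prod_type, ite_mul, mul_ite]

theorem compOp_compOp (w : Matrix ι ι A) (X Y : Matrix (ι × ι) (ι × ι) A) :
    compOp (compOp w X) Y = compOp w (X * Y) := by
  ext a b
  simp only [compOp, Matrix.mul_apply, Finset.sum_mul, Finset.mul_sum, mul_assoc]
  exact Finset.sum_comm

theorem compOp_one (w : Matrix ι ι A) : compOp w 1 = w := by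
  ext a b
  simp [compOp, Matrix.one_apply]

theorem compOp_leg2 (w S : Matrix ι ι A) : compOp w (leg2 S) = w * S := by
  ext a b
  simp [compOp, leg2, Matrix.mul_apply, Fintype.sum_prod_type, mul_ite]

theorem compOp_leg1 (w S : Matrix ι ι ℂ) : compOp w (leg1 S) = S.transpose * w := by
  ext a b
  simp [compOp, leg1, Matrix.mul_apply, Fintype.sum_prod_type, mul_ite, mul_comm]

theorem leg12_leg1_mul_cup23 (M : Matrix ι ι A) (u : Matrix ι ι ℂ) [Algebra ℂ A] :
    leg12 (leg1 M) * (cup23 u).map (algebraMap ℂ A) = (cup23 u).map (algebraMap ℂ A) * M := by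
  ext ⟨a, b, c⟩ d
  simp [leg12, leg1, cup23, Matrix.mul_apply, Fintype.sum_prod_type, ite_mul, mul_ite,
    apply_ite (algebraMap ℂ A)]
  exact (Algebra.commutes _ _).symm

theorem cap23_mul_leg12_leg1 (M : Matrix ι ι A) (w : Matrix ι ι ℂ) [Algebra ℂ A] :
    (cap23 w).map (algebraMap ℂ A) * leg12 (leg1 M) = M * (cap23 w).map (algebraMap ℂ A) := by
  ext d ⟨a, b, c⟩
  simp [leg12, leg1, cap23, Matrix.mul_apply, Fintype.sum_prod_type, ite_mul, mul_ite,
    apply_ite (algebraMap ℂ A)]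
  exact Algebra.commutes _ _

theorem leg12_mul_leg23_leg2 (X : Matrix (ι × ι) (ι × ι) A) (S : Matrix ι ι ℂ) [Algebra ℂ A] :
    leg12 X * leg23 (leg2 (S.map (algebraMap ℂ A))) =
      leg23 (leg2 (S.map (algebraMap ℂ A))) * leg12 X := by
  ext ⟨a, b, c⟩ ⟨d, e, f⟩
  simp [leg12, leg23, leg2, Matrix.mul_apply, Fintype.sum_prod_type, ite_mul, mul_ite]
  exact (Algebra.commutes _ _).symm

theorem leg12_mul_leg23_leg2' (X : Matrix (ι × ι) (ι × ι) ℂ) (S : Matrix ι ι ℂ) :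
    leg12 X * leg23 (leg2 S) = leg23 (leg2 S) * leg12 X := by
  simpa using leg12_mul_leg23_leg2 X S

theorem leg12_leg2 (S : Matrix ι ι A) : leg12 (leg2 S) = leg23 (leg1 S) := by
  ext ⟨a, b, c⟩ ⟨d, e, f⟩
  simp only [leg12, leg23, leg1, leg2]
  split_ifs <;> rfl

end General

end LegCalculus

/-! ### Relations among $R$ and $K$ for BMW type R-matrices. -/

section BMW

section Abstract

variable {T : Type*} [Ring T] [Algebra ℂ T]

/-- Transfers intertwining relations from $R$ to $K$, which is a quadratic polynomial in $R$. -/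
theorem intertwine_quadratic {X a b : T} (h : X * a = b * X) (κ s t : ℂ) :
    X * (κ • ((s • 1 - a) * (t • 1 + a))) = (κ • ((s • 1 - b) * (t • 1 + b))) * X := by
  have h1 : X * (s • 1 - a) = (s • 1 - b) * X := by
    rw [mul_sub, sub_mul, h]; simp
  have h2 : X * (t • 1 + a) = (t • 1 + b) * X := by
    rw [mul_add, add_mul, h]; simp
  rw [mul_smul_comm, smul_mul_assoc, ← mul_assoc, h1, mul_assoc, h2, mul_assoc]

theorem cap_mul_braid_mul_cap {R₁ R₂ K₁ K₂ : T} {μ : ℂ} (hμ : μ ≠ 0)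
    (hKK : K₂ * K₁ = R₁ * R₂ * K₁) (hK : K₁ * K₂ * K₁ = K₁) (hKR : K₁ * R₁ = μ • K₁) :
    K₁ * R₂ * K₁ = μ⁻¹ • K₁ := by
  have h : μ • (K₁ * R₂ * K₁) = K₁ := by
    rw [mul_assoc, hKK, mul_assoc, ← mul_assoc, hKR, smul_mul_assoc, ← mul_assoc] at hK
    exact hK
  rw [← h, mul_assoc, smul_smul, inv_mul_cancel₀ hμ, one_smul, ← mul_assoc, h]

/-- The mirror of $K_1K_2K_1=K_1$ is not among the axioms; it follows because $R_1R_2$ conjugates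
$K_1$ into $K_2$, after cancelling $R_1R_2$ on the right. -/
theorem cap_mul_cap_mul_cap {R₁ R₂ K₁ K₂ : T} {μ : ℂ} (hμ : μ ≠ 0)
    (hKK : K₂ * K₁ = R₁ * R₂ * K₁) (hK : K₁ * K₂ * K₁ = K₁) (hKR : K₁ * R₁ = μ • K₁)
    (hb : R₁ * R₂ * K₁ = K₂ * (R₁ * R₂)) (hu : IsUnit (R₁ * R₂)) :
    K₂ * K₁ * K₂ = K₂ := by
  refine hu.mul_right_cancel ?_
  calc K₂ * K₁ * K₂ * (R₁ * R₂) = K₂ * ((K₁ * R₁) * R₂ * K₁) := by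
        rw [mul_assoc, ← hb]; simp only [mul_assoc]
    _ = K₂ * (μ • (K₁ * R₂ * K₁)) := by rw [hKR, smul_mul_assoc, smul_mul_assoc]
    _ = K₂ * K₁ := by
        rw [cap_mul_braid_mul_cap hμ hKK hK hKR, smul_smul, mul_inv_cancel₀ hμ, one_smul]
    _ = K₂ * (R₁ * R₂) := by rw [hKK, hb]

end Abstract

variable {ι : Type u} [Fintype ι] [DecidableEq ι] {q μ : ℂ}
  {R F : Matrix (ι × ι) (ι × ι) ℂ}

theorem leg12_opK (q μ : ℂ) (R : Matrix (ι × ι) (ι × ι) ℂ) : leg12 (opK q μ R) =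
    (μ⁻¹ * (q - q⁻¹)⁻¹) • ((q • 1 - leg12 R) * (q⁻¹ • 1 + leg12 R)) := by
  rw [opK, leg12_smul, leg12_mul, leg12_sub, leg12_add, leg12_smul, leg12_smul, leg12_one]

theorem leg23_opK (q μ : ℂ) (R : Matrix (ι × ι) (ι × ι) ℂ) : leg23 (opK q μ R) =
    (μ⁻¹ * (q - q⁻¹)⁻¹) • ((q • 1 - leg23 R) * (q⁻¹ • 1 + leg23 R)) := by
  rw [opK, leg23_smul, leg23_mul, leg23_sub, leg23_add, leg23_smul, leg23_smul, leg23_one]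

theorem leg12_inv_mul_cancel {X : Matrix (ι × ι) (ι × ι) ℂ} (h : IsUnit X) :
    leg12 X⁻¹ * leg12 X = 1 := by
  rw [← leg12_mul, Matrix.nonsing_inv_mul _ ((Matrix.isUnit_iff_isUnit_det _).1 h), leg12_one]

theorem leg12_mul_inv_cancel {X : Matrix (ι × ι) (ι × ι) ℂ} (h : IsUnit X) :
    leg12 X * leg12 X⁻¹ = 1 := by
  rw [← leg12_mul, Matrix.mul_nonsing_inv _ ((Matrix.isUnit_iff_isUnit_det _).1 h), leg12_one]

theorem leg23_inv_mul_cancel {X : Matrix (ι × ι) (ι × ι) ℂ} (h : IsUnit X) :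
    leg23 X⁻¹ * leg23 X = 1 := by
  rw [← leg23_mul, Matrix.nonsing_inv_mul _ ((Matrix.isUnit_iff_isUnit_det _).1 h), leg23_one]

theorem leg23_mul_inv_cancel {X : Matrix (ι × ι) (ι × ι) ℂ} (h : IsUnit X) :
    leg23 X * leg23 X⁻¹ = 1 := by
  rw [← leg23_mul, Matrix.mul_nonsing_inv _ ((Matrix.isUnit_iff_isUnit_det _).1 h), leg23_one]

namespace IsBMWType

variable (hR : IsBMWType q μ R)
include hR

theorem q_sub_inv_ne_zero : q - q⁻¹ ≠ 0 := by
  intro h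
  have h1 : q * q = 1 := by
    have := congrArg (q * ·) h
    simp only [mul_sub, mul_inv_cancel₀ hR.q_ne_zero, mul_zero] at this
    linear_combination this
  rcases mul_self_eq_one_iff.1 h1 with h2 | h2
  · exact hR.q_ne_one h2
  · exact hR.q_ne_neg_one h2

theorem eta_ne_zero : eta q μ ≠ 0 := by
  refine div_ne_zero (mul_ne_zero (sub_ne_zero.2 hR.mu_ne_q.symm) ?_)
    (mul_ne_zero hR.mu_ne_zero hR.q_sub_inv_ne_zero)
  intro h
  exact hR.mu_ne_neg_q_inv (by linear_combination h)

theorem opK_mul_self_right : opK q μ R * R = μ • opK q μ R := by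
  have h := minpoly.aeval ℂ R
  rw [hR.minpoly_eq] at h
  simp only [map_mul, map_sub, map_add, Polynomial.aeval_X, Polynomial.aeval_C,
    Algebra.algebraMap_eq_smul_one] at h
  have h2 : opK q μ R * (R - μ • 1) = 0 := by
    rw [opK, smul_mul_assoc, add_comm, ← neg_sub R, neg_mul, neg_mul, h, neg_zero, smul_zero]
  rw [mul_sub, sub_eq_zero] at h2
  simpa using h2

theorem self_mul_opK : R * opK q μ R = μ • opK q μ R := by
  rw [← hR.opK_mul_self_right, opK]
  exact intertwine_quadratic (X := R) (a := R) (b := R) rfl _ _ _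

theorem opK_mul_opK : opK q μ R * opK q μ R = eta q μ • opK q μ R := by
  have h := hR.opK_mul_self_right
  conv_lhs => arg 2; rw [opK]
  rw [mul_smul_comm, ← mul_assoc, mul_sub, mul_smul_comm, mul_one, h, ← sub_smul, smul_mul_assoc,
    mul_add, mul_smul_comm, mul_one, h, ← add_smul, smul_smul, smul_smul, eta]
  congr 1
  rw [div_eq_mul_inv, mul_inv]
  ring

open Polynomial in
-- If $K$ vanished, $R$ would satisfy a quadratic equation, while its minimal polynomial is cubic.
theorem opK_ne_zero : opK q μ R ≠ 0 := by
  intro h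
  have hc : μ⁻¹ * (q - q⁻¹)⁻¹ ≠ 0 :=
    mul_ne_zero (inv_ne_zero hR.mu_ne_zero) (inv_ne_zero hR.q_sub_inv_ne_zero)
  have h1 : aeval R ((X - C q) * (X + C q⁻¹) : ℂ[X]) = 0 := by
    have h2 := (smul_eq_zero.1 h).resolve_left hc
    simp only [map_mul, map_sub, map_add, aeval_X, aeval_C, Algebra.algebraMap_eq_smul_one]
    rw [← neg_sub (q • (1 : Matrix (ι × ι) (ι × ι) ℂ)), neg_mul, add_comm R, h2, neg_zero]
  have hm : ((X - C q) * (X + C q⁻¹) : ℂ[X]).Monic := (monic_X_sub_C q).mul (monic_X_add_C _)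
  have h3 := natDegree_le_of_dvd (minpoly.dvd ℂ R h1) hm.ne_zero
  rw [hR.minpoly_eq, hm.natDegree_mul (monic_X_sub_C μ), natDegree_X_sub_C] at h3
  omega

theorem leg12_opK_mul : leg12 (opK q μ R) * leg12 R = μ • leg12 (opK q μ R) := by
  rw [← leg12_mul, hR.opK_mul_self_right, leg12_smul]

theorem leg23_mul_opK : leg23 R * leg23 (opK q μ R) = μ • leg23 (opK q μ R) := by
  rw [← leg23_mul, hR.self_mul_opK, leg23_smul]

theorem leg_braid_opK : leg12 R * leg23 R * leg12 (opK q μ R) =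
    leg23 (opK q μ R) * (leg12 R * leg23 R) := by
  rw [leg12_opK, leg23_opK]
  refine intertwine_quadratic ?_ _ _ _
  rw [hR.isRMatrix.2, mul_assoc]

theorem leg23_opK_mul_leg12_mul_leg23 :
    leg23 (opK q μ R) * leg12 (opK q μ R) * leg23 (opK q μ R) = leg23 (opK q μ R) := by
  have hu : IsUnit (leg12 R * leg23 R) := by
    have h1 : IsUnit (leg12 R) := ⟨⟨leg12 R, leg12 R⁻¹, leg12_mul_inv_cancel hR.isRMatrix.1,
      leg12_inv_mul_cancel hR.isRMatrix.1⟩, rfl⟩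
    have h2 : IsUnit (leg23 R) := ⟨⟨leg23 R, leg23 R⁻¹, leg23_mul_inv_cancel hR.isRMatrix.1,
      leg23_inv_mul_cancel hR.isRMatrix.1⟩, rfl⟩
    exact h1.mul h2
  exact cap_mul_cap_mul_cap hR.mu_ne_zero hR.K_mul_K hR.K_mul_K_mul_K hR.leg12_opK_mul
    hR.leg_braid_opK hu

/-- In $K_2K_1K_2=K_2$ replace $K_2K_1$ by $K_2R_1R_2$ and absorb $R_2$ into the last $K_2$ at the
cost of $\mu$. -/
theorem leg23_opK_mul_braid_mul :
    leg23 (opK q μ R) * leg12 R * leg23 (opK q μ R) = μ⁻¹ • leg23 (opK q μ R) := by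
  have h := hR.leg23_opK_mul_leg12_mul_leg23
  rw [hR.K_mul_K, hR.leg_braid_opK, mul_assoc, mul_assoc, hR.leg23_mul_opK, mul_smul_comm,
    mul_smul_comm, ← mul_assoc] at h
  conv_rhs => rw [← h]
  rw [smul_smul, inv_mul_cancel₀ hR.mu_ne_zero, one_smul]

end IsBMWType

end BMW

/-! ### Skew invertibility forces $K$ to have rank one. -/

section RankOne

variable {ι : Type u} [Fintype ι] [DecidableEq ι] {q μ : ℂ}
  {R F : Matrix (ι × ι) (ι × ι) ℂ}

theorem isSkewInverse_skewInverse {X : Matrix (ι × ι) (ι × ι) ℂ} (h : SkewInvertible X) :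
    IsSkewInverse X (skewInverse X) := by
  rw [skewInverse, dif_pos h]
  exact h.choose_spec

theorem IsSkewInverse.sum_left {X Ψ : Matrix (ι × ι) (ι × ι) ℂ} (h : IsSkewInverse X Ψ)
    (a b d e : ι) : ∑ k, ∑ l, X (a, k) (b, l) * Ψ (l, d) (k, e) =
      if a = e ∧ d = b then 1 else 0 := by
  have := congrFun (congrFun h.1 (a, d)) (b, e)
  simpa [trMiddle, permOp, leg12, leg23, Matrix.mul_apply, Fintype.sum_prod_type, ite_mul,
    mul_ite] using this

theorem IsSkewInverse.sum_right {X Ψ : Matrix (ι × ι) (ι × ι) ℂ} (h : IsSkewInverse X Ψ)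
    (a b d e : ι) : ∑ k, ∑ l, Ψ (a, k) (b, l) * X (l, d) (k, e) =
      if a = e ∧ d = b then 1 else 0 := by
  have := congrFun (congrFun h.2 (a, d)) (b, e)
  simpa [trMiddle, permOp, leg12, leg23, Matrix.mul_apply, Fintype.sum_prod_type, ite_mul,
    mul_ite] using this

/-- For skew invertible `R`, the relation `R₁ R₂ K₁ = K₂ K₁` makes the flip `P₁₃ K₁₄` factor
through an operator acting in the spaces 3, 4 only. -/
theorem exists_flip_factor {R K Ψ : Matrix (ι × ι) (ι × ι) ℂ} (hΨ : IsSkewInverse R Ψ)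
    (h : leg23 K * leg12 K = leg12 R * leg23 R * leg12 K) :
    ∃ W : ι → ι → ι → ι → ℂ, ∀ a c d c' j,
      (if a = c' then K (c, d) j else 0) = ∑ e, W c d c' e * K (a, e) j := by
  have h1 : ∀ a b c c' j, ∑ x, ∑ y, ∑ z, R (a, b) (x, y) * R (y, c) (z, c') * K (x, z) j =
      ∑ y, K (b, c) (y, c') * K (a, y) j := by
    intro a b c c' j
    have := congrFun (congrFun h (a, b, c)) (j.1, j.2, c')
    rw [mul_assoc] at this
    simp [leg12, leg23, Matrix.mul_apply, Fintype.sum_prod_type, ite_mul, mul_ite] at this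
    rw [this]
    simp only [Finset.mul_sum, mul_assoc]
  -- Contracting with $\Psi$ strips $R_2$. The coefficient on the right does not involve the index
  -- $a$, which is what makes the factorization possible.
  have h2 : ∀ a b p p' j, ∑ x, R (a, b) (x, p') * K (x, p) j =
      ∑ y, (∑ c, ∑ c', K (b, c) (y, c') * Ψ (c', p) (c, p')) * K (a, y) j := by
    intro a b p p' j
    calc ∑ x, R (a, b) (x, p') * K (x, p) j
        = ∑ x, ∑ y, ∑ z, R (a, b) (x, y) * K (x, z) j *
            ∑ c, ∑ c', R (y, c) (z, c') * Ψ (c', p) (c, p') := by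
          simp only [hΨ.sum_left, ite_and, mul_ite, mul_one, mul_zero, Finset.sum_ite_eq,
            Finset.mem_univ, if_true]
          simp
      _ = ∑ c, ∑ c', (∑ x, ∑ y, ∑ z, R (a, b) (x, y) * R (y, c) (z, c') * K (x, z) j) *
            Ψ (c', p) (c, p') := by
          simp only [Finset.mul_sum, Finset.sum_mul, ← Fintype.sum_prod_type']
          exact Fintype.sum_equiv ⟨fun t => (t.2.2.2.1, t.2.2.2.2, t.1, t.2.1, t.2.2.1),
            fun t => (t.2.2.1, t.2.2.2.1, t.2.2.2.2, t.1, t.2.1), fun _ => rfl, fun _ => rfl⟩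
            _ _ fun _ => by dsimp; ring
      _ = _ := by
          simp only [h1]
          simp only [Finset.mul_sum, Finset.sum_mul, ← Fintype.sum_prod_type']
          exact Fintype.sum_equiv ⟨fun t => (t.2.2, t.1, t.2.1),
            fun t => (t.2.1, t.2.2, t.1), fun _ => rfl, fun _ => rfl⟩
            _ _ fun _ => by dsimp; ring
  -- A second contraction with $\Psi$ strips the remaining $R$, and the coefficients left over form
  -- $W$.
  refine ⟨fun s p s' y => ∑ b, ∑ p', (∑ c, ∑ c', K (b, c) (y, c') * Ψ (c', p) (c, p')) *
    Ψ (p', s) (b, s'), fun a s p s' j => ?_⟩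
  calc (if a = s' then K (s, p) j else 0)
      = ∑ x, K (x, p) j * ∑ b, ∑ p', R (a, b) (x, p') * Ψ (p', s) (b, s') := by
        simp only [hΨ.sum_left, ite_and, mul_ite, mul_one, mul_zero, Finset.sum_ite_eq,
            Finset.mem_univ, if_true]
        by_cases hh : a = s' <;> simp [hh]
    _ = ∑ b, ∑ p', (∑ x, R (a, b) (x, p') * K (x, p) j) * Ψ (p', s) (b, s') := by
        simp only [Finset.mul_sum, Finset.sum_mul, ← Fintype.sum_prod_type']
        exact Fintype.sum_equiv ⟨fun t => (t.2.1, t.2.2, t.1),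
            fun t => (t.2.2, t.1, t.2.1), fun _ => rfl, fun _ => rfl⟩
            _ _ fun _ => by dsimp; ring
    _ = _ := by
        simp only [h2]
        simp only [Finset.mul_sum, Finset.sum_mul, ← Fintype.sum_prod_type']
        exact Fintype.sum_equiv ⟨fun t => (t.2.2.1, t.1, t.2.1, t.2.2.2.1, t.2.2.2.2),
            fun t => (t.2.1, t.2.2.1, t.1, t.2.2.2.1, t.2.2.2.2), fun _ => rfl, fun _ => rfl⟩
            _ _ fun _ => by dsimp; ring

/-- A nonzero operator whose flip factors as in `exists_flip_factor` has rank one, with a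
nondegenerate image vector. -/
theorem exists_eq_outer {K : Matrix (ι × ι) (ι × ι) ℂ} (hK : K ≠ 0) {W : ι → ι → ι → ι → ℂ}
    (hW : ∀ a c d c' j, (if a = c' then K (c, d) j else 0) = ∑ e, W c d c' e * K (a, e) j) :
    ∃ u w : Matrix ι ι ℂ, IsUnit u ∧ K = outer u w := by
  obtain ⟨c₀, d₀, j₀, h₀⟩ : ∃ c d j, K (c, d) j ≠ 0 := by
    by_contra! h
    exact hK (by ext ⟨c, d⟩ j; exact h c d j)
  -- A nonzero column of $K$, reshaped as a matrix, serves as $u$. A row vector $x$ with $xU=0$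
  -- kills the right side of `hW`, whose left side is then $x_{c'}K_{(c_0,d_0),j_0}$; so $x=0$.
  let U : Matrix ι ι ℂ := fun a b => K (a, b) j₀
  have hU : IsUnit U := by
    rw [Matrix.isUnit_iff_isUnit_det, isUnit_iff_ne_zero]
    intro hdet
    obtain ⟨x, hx, hxU⟩ := Matrix.exists_vecMul_eq_zero_iff.2 hdet
    refine hx (funext fun c' => ?_)
    have h1 : ∑ a, x a * (if a = c' then K (c₀, d₀) j₀ else 0) = 0 := by
      simp only [hW _ c₀ d₀, Finset.mul_sum]
      rw [Finset.sum_comm]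
      refine Finset.sum_eq_zero fun e _ => ?_
      have h2 : ∑ a, x a * K (a, e) j₀ = 0 := congrFun hxU e
      calc ∑ a, x a * (W c₀ d₀ c' e * K (a, e) j₀)
          = W c₀ d₀ c' e * ∑ a, x a * K (a, e) j₀ := by
            rw [Finset.mul_sum]; exact Finset.sum_congr rfl fun _ _ => by ring
        _ = 0 := by rw [h2, mul_zero]
    simpa [h₀] using h1
  -- With $K_j$ the reshaped column $j$, the coefficient of $u$ in it is the entry $(c_0,c_0)$ of
  -- $K_jU^{-1}$: write $K_j=(K_jU^{-1})U$ in `hW` and apply `hW` once more to the column $j_0$.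
  refine ⟨U, fun a b => ∑ e, K (c₀, e) (a, b) * U⁻¹ e c₀, hU, ?_⟩
  ext ⟨c, d⟩ j
  have hC : ∀ a e, K (a, e) j = ∑ b, (∑ f, K (a, f) j * U⁻¹ f b) * U b e := by
    intro a e
    have h1 := congrFun (congrFun (Matrix.nonsing_inv_mul_cancel_right (A := U)
      (Matrix.of fun a f => K (a, f) j) ((Matrix.isUnit_iff_isUnit_det _).1 hU)) a) e
    simp only [Matrix.mul_apply, Matrix.of_apply] at h1
    exact h1.symm
  have h2 := hW c₀ c d c₀ j
  simp only [if_true] at h2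
  rw [h2]
  calc ∑ e, W c d c₀ e * K (c₀, e) j
      = ∑ e, W c d c₀ e * ∑ b, (∑ f, K (c₀, f) j * U⁻¹ f b) * U b e :=
        Finset.sum_congr rfl fun e _ => by rw [← hC]
    _ = ∑ b, (∑ f, K (c₀, f) j * U⁻¹ f b) * ∑ e, W c d c₀ e * K (b, e) j₀ := by
        simp only [Finset.mul_sum]
        rw [Finset.sum_comm]
        refine Finset.sum_congr rfl fun _ _ => Finset.sum_congr rfl fun _ _ => ?_
        simp only [U]; ring
    _ = outer U (fun a b => ∑ e, K (c₀, e) (a, b) * U⁻¹ e c₀) (c, d) j := by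
        simp only [← hW, mul_ite, mul_zero, Finset.sum_ite_eq', Finset.mem_univ, if_true, outer]
        rw [mul_comm]

end RankOne

/-! ### The pair $(u,w)$ and the matrix $D_R$. -/

section Pairing

variable {ι : Type u} [Fintype ι] [DecidableEq ι] {q μ : ℂ}
  {R F : Matrix (ι × ι) (ι × ι) ℂ} {u w : Matrix ι ι ℂ}

/-- The rank one form `K = u ⊗ w` of the operator `K`, with its elementary consequences. -/
structure IsPairing (q μ : ℂ) (R : Matrix (ι × ι) (ι × ι) ℂ) (u w : Matrix ι ι ℂ) : Prop where
  eta_ne_zero : eta q μ ≠ 0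
  opK_eq : opK q μ R = outer u w
  isUnit_cup : IsUnit u
  isUnit_cap : IsUnit w
  sum_eq : ∑ k : ι × ι, w k.1 k.2 * u k.1 k.2 = eta q μ
  mul_eq_one : u * w * (w * u).transpose = 1
  matD_eq : matD R = μ • (u * w.transpose)

theorem outer_mul_outer (u w : Matrix ι ι ℂ) :
    outer u w * outer u w = (∑ k : ι × ι, w k.1 k.2 * u k.1 k.2) • outer u w := by
  ext i j
  simp only [outer, Matrix.mul_apply, Matrix.smul_apply, smul_eq_mul, Finset.sum_mul]
  exact Finset.sum_congr rfl fun _ _ => by ring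

/-- Closing both ends with a cap and a cup produces the loop value twice, and it can be cancelled.
-/
theorem eq_of_cup23_mul_cap23 {e : ℂ} (he : e ≠ 0)
    (hs : ∑ k : ι × ι, w k.1 k.2 * u k.1 k.2 = e) {X Y : Matrix ι ι ℂ}
    (h : cup23 u * X * cap23 w = cup23 u * Y * cap23 w) : X = Y := by
  have h1 : cap23 w * cup23 u = e • 1 := by rw [cap23_mul_cup23, hs]
  have h2 := congrArg (fun Z => cap23 w * Z * cup23 u) h
  simp only [Matrix.mul_assoc, h1] at h2
  simp only [← Matrix.mul_assoc, h1, Matrix.smul_mul, Matrix.mul_smul, Matrix.one_mul,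
    Matrix.mul_one] at h2
  exact smul_right_injective _ he (smul_right_injective _ he h2)

/-- Once $K=u\otimes w$, each relation of the form $K_2ZK_2=\lambda K_2$ reduces to an identity of
matrices on $V$, obtained by removing the outer cup and cap. -/
theorem IsBMWType.exists_isPairing (hR : IsBMWType q μ R) (hRs : SkewInvertible R) :
    ∃ u w, IsPairing q μ R u w := by
  have hΨ := isSkewInverse_skewInverse hRs
  obtain ⟨W, hW⟩ := exists_flip_factor hΨ hR.K_mul_K
  obtain ⟨u, w, hu, hK⟩ := exists_eq_outer hR.opK_ne_zero hW
  have hs : ∑ k : ι × ι, w k.1 k.2 * u k.1 k.2 = eta q μ := by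
    have h := hR.opK_mul_opK
    have h0 := hR.opK_ne_zero
    rw [hK] at h h0
    rw [outer_mul_outer] at h
    exact smul_left_injective ℂ h0 h
  have h1 : u * w * (w * u).transpose = 1 := by
    have h := hR.leg23_opK_mul_leg12_mul_leg23
    rw [hK, leg12_outer, leg23_outer] at h
    refine eq_of_cup23_mul_cap23 hR.eta_ne_zero hs ?_
    rw [← cap23_mul_cup12 w u, ← cap12_mul_cup23 w u, Matrix.mul_one]
    simpa only [Matrix.mul_assoc] using h
  have h2 : cap23 w * leg12 R * cup23 u = μ⁻¹ • 1 := by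
    have h := hR.leg23_opK_mul_braid_mul
    rw [hK, leg23_outer] at h
    refine eq_of_cup23_mul_cap23 hR.eta_ne_zero hs ?_
    rw [Matrix.mul_smul, Matrix.mul_one, Matrix.smul_mul]
    simpa only [Matrix.mul_assoc] using h
  -- In indices: contracting the second leg of $R$ with $uw^{T}$ gives $\mu^{-1}I$.
  have h3 : ∀ l k, ∑ d, ∑ e, R (l, d) (k, e) * (∑ c, u e c * w d c) = if l = k then μ⁻¹ else 0 := by
    intro l k
    have h := congrFun (congrFun h2 l) k
    simp [cap23, leg12, cup23, Matrix.mul_apply, Fintype.sum_prod_type, ite_mul, mul_ite,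
      Matrix.one_apply] at h
    rw [← h]
    simp only [Finset.mul_sum, Finset.sum_mul, ← Fintype.sum_prod_type']
    exact Fintype.sum_equiv ⟨fun t => (t.2.1, t.2.2, t.1), fun t => (t.2.2, t.1, t.2.1),
      fun _ => rfl, fun _ => rfl⟩ _ _ fun _ => by dsimp; ring
  refine ⟨u, w, hR.eta_ne_zero, hK, hu, ?_, hs, h1, ?_⟩
  · have h4 : IsUnit (u * w) := by
      rw [Matrix.isUnit_iff_isUnit_det]
      exact IsUnit.of_mul_eq_one _ (by rw [← Matrix.det_mul, h1, Matrix.det_one])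
    rw [Matrix.isUnit_iff_isUnit_det, Matrix.det_mul] at h4
    exact (Matrix.isUnit_iff_isUnit_det _).2 (isUnit_of_mul_isUnit_right h4)
  · ext a b
    -- Applying the skew inverse undoes the contraction with $R$ and isolates $uw^{T}$; by `h3` the
    -- same expression is $\mu^{-1}D_R$.
    have h5 : ∑ k, ∑ l, skewInverse R (a, k) (b, l) *
        ∑ d, ∑ e, R (l, d) (k, e) * (∑ c, u e c * w d c) = ∑ c, u a c * w b c := by
      calc _ = ∑ d, ∑ e, (∑ k, ∑ l, skewInverse R (a, k) (b, l) * R (l, d) (k, e)) *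
            (∑ c, u e c * w d c) := by
            simp only [Finset.mul_sum, Finset.sum_mul, ← Fintype.sum_prod_type']
            exact Fintype.sum_equiv ⟨fun t => (t.2.2.1, t.2.2.2.1, t.2.2.2.2, t.1, t.2.1),
              fun t => (t.2.2.2.1, t.2.2.2.2, t.1, t.2.1, t.2.2.1), fun _ => rfl, fun _ => rfl⟩
              _ _ fun _ => by dsimp; ring
        _ = _ := by
            simp only [hΨ.sum_right, ite_and, ite_mul, one_mul, zero_mul]
            simp
    simp only [h3, mul_ite, mul_zero, Finset.sum_ite_eq', Finset.mem_univ, if_true] at h5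
    rw [Matrix.smul_apply, Matrix.mul_apply, matD, tr2]
    simp only [Matrix.transpose_apply]
    rw [← h5, ← Finset.sum_mul, smul_eq_mul, mul_comm _ μ⁻¹, mul_inv_cancel_left₀ hR.mu_ne_zero]

namespace IsPairing

variable (hP : IsPairing q μ R u w)
include hP

theorem cap12_mul_cup12 : cap12 w * cup12 u = eta q μ • 1 := by
  rw [QuantumMatrix.cap12_mul_cup12, hP.sum_eq]

theorem cap23_mul_cup23 : cap23 w * cup23 u = eta q μ • 1 := by
  rw [QuantumMatrix.cap23_mul_cup23, hP.sum_eq]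

theorem isUnit_cap12_mul_cup23 : IsUnit (cap12 w * cup23 u) := by
  rw [cap12_mul_cup23, Matrix.isUnit_transpose]
  exact hP.isUnit_cap.mul hP.isUnit_cup

theorem leg12_opK_eq : leg12 (opK q μ R) = cup12 u * cap12 w := by
  rw [hP.opK_eq, leg12_outer]

theorem leg23_opK_eq : leg23 (opK q μ R) = cup23 u * cap23 w := by
  rw [hP.opK_eq, leg23_outer]

/-- `Tr_R₍₂₎ K = μ I`. -/
theorem tr2_matD_mul_opK : tr2 (leg2 (matD R) * opK q μ R) = μ • 1 := by
  have h1 : u * (w * matD R).transpose = μ • 1 := by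
    rw [hP.matD_eq, Matrix.mul_smul, Matrix.transpose_smul, Matrix.mul_smul, ← hP.mul_eq_one]
    simp only [Matrix.transpose_mul, Matrix.transpose_transpose, Matrix.mul_assoc]
  rw [← h1, hP.opK_eq]
  ext a b
  simp [tr2, leg2, outer, Matrix.mul_apply, Fintype.sum_prod_type, ite_mul, mul_ite,
    Finset.mul_sum]
  rw [Finset.sum_comm]
  exact Finset.sum_congr rfl fun _ _ => Finset.sum_congr rfl fun _ _ => by ring

theorem trace_matD : (matD R).trace = μ * eta q μ := by
  rw [hP.matD_eq, Matrix.trace_smul, ← hP.sum_eq, smul_eq_mul, Matrix.trace,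
    Fintype.sum_prod_type]
  simp [Matrix.mul_apply, mul_comm]

theorem trace_matD_mul_opK :
    Matrix.trace (leg1 (matD R) * leg2 (matD R) * opK q μ R) = μ ^ 2 * eta q μ := by
  have h : Matrix.trace (leg1 (matD R) * (leg2 (matD R) * opK q μ R)) =
      Matrix.trace (matD R * tr2 (leg2 (matD R) * opK q μ R)) := by
    generalize leg2 (matD R) * opK q μ R = X
    simp [Matrix.trace, tr2, leg1, Matrix.mul_apply, Fintype.sum_prod_type, Finset.mul_sum,
      ite_mul]
    exact Finset.sum_congr rfl fun _ _ => Finset.sum_comm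
  rw [Matrix.mul_assoc, h, hP.tr2_matD_mul_opK, Matrix.mul_smul, Matrix.mul_one,
    Matrix.trace_smul, hP.trace_matD, smul_eq_mul]
  ring

end IsPairing

end Pairing

/-! ### Passing the cap and the cup through two crossings $F$. -/

section Twist

variable {ι : Type u} [Fintype ι] [DecidableEq ι] {q μ : ℂ}
  {R F : Matrix (ι × ι) (ι × ι) ℂ} {u w : Matrix ι ι ℂ}

/-- An invertible operator intertwining the idempotents (up to scaling) `u₁ c₁` and `u₂ c₂`
induces an invertible operator between their images. -/
theorem exists_isUnit_transport {κ : Type*} [Fintype κ] [DecidableEq κ] {c₁ c₂ : Matrix ι κ ℂ}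
    {u₁ u₂ : Matrix κ ι ℂ} {e : ℂ} (he : e ≠ 0) (h₁ : c₁ * u₁ = e • 1) (h₂ : c₂ * u₂ = e • 1)
    {X X' : Matrix κ κ ℂ} (hX : X * X' = 1) (h : u₁ * c₁ * X = X * (u₂ * c₂)) :
    ∃ Y : Matrix ι ι ℂ, IsUnit Y ∧ c₁ * X = Y * c₂ ∧ X * u₂ = u₁ * Y := by
  have h3 : c₁ * X = (e⁻¹ • (c₁ * X * u₂)) * c₂ := by
    have h4 := congrArg (fun Z => e⁻¹ • (c₁ * Z)) h
    simp only [← Matrix.mul_assoc, h₁, Matrix.smul_mul, Matrix.one_mul, smul_smul,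
      inv_mul_cancel₀ he, one_smul] at h4
    rw [Matrix.smul_mul]
    exact h4
  refine ⟨e⁻¹ • (c₁ * X * u₂), ?_, h3, ?_⟩
  · rw [Matrix.isUnit_iff_isUnit_det]
    -- The inverse is transported the same way by $X'$, with the roles of the two images exchanged.
    refine IsUnit.of_mul_eq_one (e⁻¹ • (c₂ * X' * u₁)).det ?_
    rw [← Matrix.det_mul, Matrix.mul_smul, ← Matrix.mul_assoc, ← Matrix.mul_assoc, ← h3,
      Matrix.mul_assoc c₁, hX, Matrix.mul_one, h₁, smul_smul, inv_mul_cancel₀ he, one_smul,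
      Matrix.det_one]
  · have h4 := congrArg (fun Z => e⁻¹ • (Z * u₂)) h
    simp only [Matrix.mul_assoc, h₂, Matrix.mul_smul, Matrix.mul_one, smul_smul,
      inv_mul_cancel₀ he, one_smul] at h4
    rw [Matrix.mul_smul, Matrix.mul_assoc]
    exact h4.symm

theorem eq_of_cap12_mul_leg23 (hw : IsUnit w) {X Y : Matrix (ι × ι) (ι × ι) ℂ}
    (h : cap12 w * leg23 X = cap12 w * leg23 Y) : X = Y := by
  ext ⟨y, c⟩ j
  have h1 : ∀ x, ∑ y, w x y * X (y, c) j = ∑ y, w x y * Y (y, c) j := by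
    intro x
    have := congrFun (congrFun h c) (x, j)
    simpa [cap12, leg23, Matrix.mul_apply, Fintype.sum_prod_type, ite_mul, mul_ite] using this
  have h2 : w.mulVec (fun y => X (y, c) j) = w.mulVec (fun y => Y (y, c) j) := funext h1
  exact congrFun (Matrix.mulVec_injective_of_isUnit hw h2) y

theorem tr23_cup23_mul (Z w u : Matrix ι ι ℂ) :
    tr23 (cup23 u * (Z * cap12 w)) = Z * (cap12 w * cup23 u) := by
  rw [cap12_mul_cup23]
  ext a b
  simp [tr23, cup23, cap12, Matrix.mul_apply, Fintype.sum_prod_type, ite_mul, mul_ite,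
    Finset.mul_sum, Matrix.transpose_apply]
  rw [Finset.sum_comm]
  exact Finset.sum_congr rfl fun _ _ => Finset.sum_congr rfl fun _ _ => by ring

/-- The covector `w` passes through two crossings `F`, up to an invertible operator, which
determines `G`. -/
theorem IsPairing.exists_cap_twist (hP : IsPairing q μ R u w) (hF : IsUnit F)
    (hRF : CompatiblePair R F) : ∃ Y : Matrix ι ι ℂ, IsUnit Y ∧
      cap12 w * (leg23 F * leg12 F) = Y * cap23 w ∧
      cap23 w * (leg12 F⁻¹ * leg23 F⁻¹) = Y⁻¹ * cap12 w ∧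
      opG q μ R F = Y⁻¹ * (cap12 w * cup23 u) := by
  have hX : leg23 F * leg12 F * (leg12 F⁻¹ * leg23 F⁻¹) = 1 := by
    rw [Matrix.mul_assoc, ← Matrix.mul_assoc (leg12 F), leg12_mul_inv_cancel hF, Matrix.one_mul,
      leg23_mul_inv_cancel hF]
  have h : leg12 (opK q μ R) * (leg23 F * leg12 F) =
      leg23 F * leg12 F * leg23 (opK q μ R) := by
    rw [leg12_opK, leg23_opK]
    refine (intertwine_quadratic ?_ _ _ _).symm
    rw [← hRF.1, mul_assoc]
  rw [hP.leg12_opK_eq, hP.leg23_opK_eq] at h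
  obtain ⟨Y, hY, h1, -⟩ := exists_isUnit_transport hP.eta_ne_zero hP.cap12_mul_cup12
    hP.cap23_mul_cup23 hX h
  have h2 : cap23 w * (leg12 F⁻¹ * leg23 F⁻¹) = Y⁻¹ * cap12 w := by
    have h3 : cap23 w = Y⁻¹ * (cap12 w * (leg23 F * leg12 F)) := by
      rw [h1, Matrix.nonsing_inv_mul_cancel_left _ _ ((Matrix.isUnit_iff_isUnit_det _).1 hY)]
    rw [h3, Matrix.mul_assoc, Matrix.mul_assoc (cap12 w), hX, Matrix.mul_one]
  refine ⟨Y, hY, h1, h2, ?_⟩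
  rw [opG, hP.leg23_opK_eq, Matrix.mul_assoc, Matrix.mul_assoc, h2, tr23_cup23_mul]

/-- The counterpart for $u$, from the other compatibility relation. Only the invertibility of $H$ is
needed, since it cancels in `IsPairing.mul_contraction`. -/
theorem IsPairing.exists_cup_twist (hP : IsPairing q μ R u w) (hF : IsUnit F)
    (hRF : CompatiblePair R F) : ∃ H : Matrix ι ι ℂ, IsUnit H ∧
      leg12 F * leg23 F * cup12 u = cup23 u * H := by
  have hX : leg12 F * leg23 F * (leg23 F⁻¹ * leg12 F⁻¹) = 1 := by
    rw [Matrix.mul_assoc, ← Matrix.mul_assoc (leg23 F), leg23_mul_inv_cancel hF, Matrix.one_mul,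
      leg12_mul_inv_cancel hF]
  have h : leg23 (opK q μ R) * (leg12 F * leg23 F) =
      leg12 F * leg23 F * leg12 (opK q μ R) := by
    rw [leg12_opK, leg23_opK]
    refine (intertwine_quadratic ?_ _ _ _).symm
    rw [← hRF.2, mul_assoc]
  rw [hP.leg12_opK_eq, hP.leg23_opK_eq] at h
  obtain ⟨H, hH, -, h1⟩ := exists_isUnit_transport hP.eta_ne_zero hP.cap23_mul_cup23
    hP.cap12_mul_cup12 hX h
  exact ⟨H, hH, h1⟩

/-- The covector `w F` is nondegenerate. -/
theorem isUnit_compOp {Y : Matrix ι ι ℂ} (hw : IsUnit w) (hF : IsRMatrix F)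
    (hY : cap12 w * (leg23 F * leg12 F) = Y * cap23 w) : IsUnit (compOp w F) := by
  obtain ⟨S, hS⟩ : ∃ S, compOp w F = w * S := ⟨w⁻¹ * compOp w F, by
    rw [Matrix.mul_nonsing_inv_cancel_left _ _ ((Matrix.isUnit_iff_isUnit_det _).1 hw)]⟩
  -- By the Yang–Baxter equation for $F$, the covector $wF$ passes through the two crossings with
  -- the same $Y$ as $w$.
  have h1 : cap12 (compOp w F) * (leg23 F * leg12 F) = Y * cap23 (compOp w F) := by
    rw [cap12_compOp, cap23_compOp, ← Matrix.mul_assoc Y, ← hY, Matrix.mul_assoc,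
      Matrix.mul_assoc (cap12 w), ← hF.2]
    simp only [Matrix.mul_assoc]
  -- Writing $wF=wS_2$ and comparing the two passages, the nondegenerate $w$ cancels and leaves a
  -- commutation of $S$ with $F$.
  have h2 : leg1 S * F = F * leg2 S := by
    refine eq_of_cap12_mul_leg23 hw ?_
    rw [hS, ← compOp_leg2, cap12_compOp, cap23_compOp, leg12_leg2, ← Matrix.mul_assoc Y, ← hY,
      Matrix.mul_assoc (cap12 w), Matrix.mul_assoc (cap12 w), Matrix.mul_assoc (leg23 F),
      leg12_mul_leg23_leg2'] at h1
    have h3 := congrArg (· * leg12 F⁻¹) h1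
    simp only [Matrix.mul_assoc, leg12_mul_inv_cancel hF.1, Matrix.mul_one] at h3
    rw [leg23_mul, leg23_mul]
    exact h3
  have hdet := (Matrix.isUnit_iff_isUnit_det _).1 hF.1
  have h3 : leg2 S * F⁻¹ = F⁻¹ * leg1 S := by
    rw [← Matrix.nonsing_inv_mul_cancel_left F (leg2 S * F⁻¹) hdet, ← Matrix.mul_assoc F, ← h2,
      Matrix.mul_assoc (leg1 S), Matrix.mul_nonsing_inv _ hdet, Matrix.mul_one]
  -- Moving $S$ through $F^{-1}$ exhibits $S^{T}$ as a left factor of the invertible $w$, so $S$ is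
  -- invertible.
  have h4 : w = S.transpose * compOp w F⁻¹ := by
    rw [← compOp_leg1, compOp_compOp, ← h3, ← compOp_compOp, compOp_leg2, ← hS, compOp_compOp,
      Matrix.mul_nonsing_inv _ hdet, compOp_one]
  rw [hS]
  refine hw.mul ?_
  rw [← Matrix.isUnit_transpose, Matrix.isUnit_iff_isUnit_det]
  rw [Matrix.isUnit_iff_isUnit_det, h4, Matrix.det_mul] at hw
  exact isUnit_of_mul_isUnit_left hw

end Twist

/-! ### Quantum matrices over a noncommutative algebra and their contraction. -/

section OverAlgebra

variable {ι : Type u} [Fintype ι] [DecidableEq ι] {q μ : ℂ}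
  {R F : Matrix (ι × ι) (ι × ι) ℂ} {u w : Matrix ι ι ℂ}
  {A : Type*} [Ring A] [Algebra ℂ A] {M : Matrix ι ι A}

theorem map_mul_smul {l m n : Type*} [Fintype m] (X : Matrix l m ℂ) (g : A) (Y : Matrix m n A) :
    X.map (algebraMap ℂ A) * (g • Y) = g • (X.map (algebraMap ℂ A) * Y) := by
  ext i j
  simp only [Matrix.mul_apply, Matrix.smul_apply, Matrix.map_apply, smul_eq_mul, Finset.mul_sum]
  exact Finset.sum_congr rfl fun _ _ => by rw [← mul_assoc, Algebra.commutes, mul_assoc]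

/-- Scalars from $\mathbb C$ are central, so $g$ moves from the left of a complex matrix to its
right, where it can stand behind $M$. -/
theorem smul_map_eq {l m : Type*} [Fintype m] [DecidableEq m] (X : Matrix l m ℂ) (g : A) :
    g • X.map (algebraMap ℂ A) = X.map (algebraMap ℂ A) * (g • (1 : Matrix m m A)) := by
  rw [map_mul_smul, Matrix.mul_one]

theorem map_smul_one (c : ℂ) :
    (c • (1 : Matrix ι ι ℂ)).map (algebraMap ℂ A) = c • (1 : Matrix ι ι A) := by
  ext i j
  by_cases h : i = j <;> simp [Matrix.one_apply, h, Algebra.algebraMap_eq_smul_one]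

theorem map_one' {κ : Type*} [DecidableEq κ] :
    (1 : Matrix κ κ ℂ).map (algebraMap ℂ A) = 1 :=
  Matrix.map_one _ (map_zero _) (map_one _)

theorem leg12_lift (X : Matrix (ι × ι) (ι × ι) ℂ) :
    leg12 (lift A X) = (leg12 X).map (algebraMap ℂ A) := by
  ext i j
  simp only [leg12, lift, Matrix.map_apply]
  split_ifs <;> simp

theorem cap12_map (X : Matrix ι ι ℂ) :
    cap12 (X.map (algebraMap ℂ A)) = (cap12 X).map (algebraMap ℂ A) := by
  ext i j
  simp only [cap12, Matrix.map_apply]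
  split_ifs <;> simp

theorem compOp_map (w : Matrix ι ι ℂ) (X : Matrix (ι × ι) (ι × ι) ℂ) :
    compOp (w.map (algebraMap ℂ A)) (X.map (algebraMap ℂ A)) =
      (compOp w X).map (algebraMap ℂ A) := by
  ext i j
  simp [compOp]

theorem cap12_injective : Function.Injective (cap12 : Matrix ι ι A → _) := by
  intro X Y h
  ext a b
  simpa [cap12] using congrFun (congrFun h a) (a, b, a)

/-- The double transpose keeps the entries of $B$ to the left of those of $M$, as they do not
commute. -/
theorem compOp_leg1_eq (B M : Matrix ι ι A) :
    compOp B (leg1 M) = (B.transpose * M).transpose := by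
  ext a b
  simp [compOp, leg1, Matrix.mul_apply, Fintype.sum_prod_type, mul_ite]

theorem leg12_leg1_mul_leg23 (M : Matrix ι ι A) (X : Matrix (ι × ι) (ι × ι) ℂ) :
    leg12 (leg1 M) * (leg23 X).map (algebraMap ℂ A) =
      (leg23 X).map (algebraMap ℂ A) * leg12 (leg1 M) := by
  ext ⟨a, b, c⟩ ⟨d, e, f⟩
  simp [leg12, leg23, leg1, Matrix.mul_apply, Fintype.sum_prod_type, ite_mul, mul_ite,
    apply_ite (algebraMap ℂ A)]
  exact (Algebra.commutes _ _).symm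

theorem lift_eq_mapMatrix {κ : Type*} [Fintype κ] [DecidableEq κ] (X : Matrix κ κ ℂ) :
    lift A X = (Algebra.ofId ℂ A).mapMatrix X := rfl

theorem lift_opK (q μ : ℂ) (R : Matrix (ι × ι) (ι × ι) ℂ) : lift A (opK q μ R) =
    (μ⁻¹ * (q - q⁻¹)⁻¹) • ((q • 1 - lift A R) * (q⁻¹ • 1 + lift A R)) := by
  simp only [lift_eq_mapMatrix, opK, map_smul, map_mul, map_sub, map_add, map_one]

/-- `K` commutes with the product of the two copies of a quantum matrix. -/
theorem mul_lift_opK_comm (hM : relLeft R F M = relRight R F M) :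
    leg1 M * copy2 F M * lift A (opK q μ R) = lift A (opK q μ R) * (leg1 M * copy2 F M) := by
  rw [lift_opK]
  refine intertwine_quadratic ?_ _ _ _
  rw [← mul_assoc]
  exact hM.symm

/-- Sandwiching by a rank one operator leaves only a scalar; here it is an element of $A$, which may
be put on the left because the entries of $u$ are central. -/
theorem outer_map_mul_mul (u w : Matrix ι ι ℂ) (X : Matrix (ι × ι) (ι × ι) A) :
    ∃ c : A, lift A (outer u w) * X * lift A (outer u w) = c • lift A (outer u w) := by
  refine ⟨∑ l : ι × ι, (∑ k : ι × ι, algebraMap ℂ A (w k.1 k.2) * X k l) *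
    algebraMap ℂ A (u l.1 l.2), ?_⟩
  ext i j
  simp only [lift, outer, Matrix.mul_apply, Matrix.map_apply, Matrix.smul_apply, smul_eq_mul,
    map_mul, Finset.sum_mul]
  refine Finset.sum_congr rfl fun l _ => Finset.sum_congr rfl fun k _ => ?_
  rw [← mul_assoc _ (algebraMap ℂ A (u i.1 i.2)) (algebraMap ℂ A (w j.1 j.2)),
    ← Algebra.commutes (u i.1 i.2)]
  simp only [mul_assoc]

/-- The product of the two copies of `M` acts on the image of `K` through the contraction. -/
theorem IsPairing.exists_contraction_eq (hP : IsPairing q μ R u w)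
    (hM : relLeft R F M = relRight R F M) : ∃ g : A,
      contraction q μ R F M = μ ^ 2 • g ∧
      leg1 M * copy2 F M * lift A (opK q μ R) = g • lift A (opK q μ R) := by
  set X := leg1 M * copy2 F M with hX
  obtain ⟨c, hc⟩ := outer_map_mul_mul u w X
  rw [← hP.opK_eq] at hc
  have hKK : lift A (opK q μ R) * lift A (opK q μ R) = eta q μ • lift A (opK q μ R) := by
    simp only [lift_eq_mapMatrix, ← map_mul, ← map_smul]
    rw [hP.opK_eq, outer_mul_outer, hP.sum_eq]
  have h1 : X * lift A (opK q μ R) = ((eta q μ)⁻¹ • c) • lift A (opK q μ R) := by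
    rw [← mul_lift_opK_comm hM, mul_assoc, hKK, mul_smul_comm] at hc
    rw [smul_assoc, ← hc, smul_smul, inv_mul_cancel₀ hP.eta_ne_zero, one_smul]
  refine ⟨_, ?_, h1⟩
  rw [contraction, rTr12, h1]
  generalize (eta q μ)⁻¹ • c = g
  have h2 : Matrix.trace (lift A (leg1 (matD R) * leg2 (matD R)) * g • lift A (opK q μ R)) =
      g * algebraMap ℂ A (Matrix.trace (leg1 (matD R) * leg2 (matD R) * opK q μ R)) := by
    rw [lift, lift, map_mul_smul, ← Matrix.map_mul, Matrix.trace_smul, smul_eq_mul]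
    congr 1
    simp only [Matrix.trace, Matrix.diag_apply, Matrix.map_apply, map_sum]
  rw [h2, hP.trace_matD_mul_opK, ← Algebra.commutes, ← Algebra.smul_def, smul_smul]
  congr 1
  rw [mul_comm, mul_assoc, mul_inv_cancel₀ hP.eta_ne_zero, mul_one]

theorem mul_rTr2 (M : Matrix ι ι A) (Z : Matrix (ι × ι) (ι × ι) A) :
    M * rTr2 R Z = rTr2 R (leg1 M * Z) := by
  have h : leg1 M * lift A (leg2 (matD R)) = lift A (leg2 (matD R)) * leg1 M := by
    ext ⟨a, b⟩ ⟨c, d⟩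
    simp [leg1, leg2, lift, Matrix.mul_apply, Fintype.sum_prod_type, ite_mul, mul_ite,
      apply_ite (algebraMap ℂ A)]
    exact (Algebra.commutes _ _).symm
  rw [rTr2, rTr2, ← mul_assoc, ← h, mul_assoc]
  generalize lift A (leg2 (matD R)) * Z = Z
  ext a b
  simp [tr2, leg1, Matrix.mul_apply, Fintype.sum_prod_type, ite_mul, Finset.mul_sum]
  exact Finset.sum_comm

/-- `M ξ(M) = μ⁻¹ g`, in the normalization of `IsPairing.exists_contraction_eq`. -/
theorem IsPairing.mul_xi (hP : IsPairing q μ R u w) {g : A}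
    (hg : leg1 M * copy2 F M * lift A (opK q μ R) = g • lift A (opK q μ R)) :
    M * xi q μ R F M = g • μ • 1 := by
  have h1 : xi q μ R F M = rTr2 R (copy2 F M * lift A (opK q μ R)) := rfl
  rw [h1, mul_rTr2, ← mul_assoc, hg, rTr2, lift, lift, map_mul_smul, ← Matrix.map_mul,
    ← map_smul_one, ← hP.tr2_matD_mul_opK]
  ext a b
  simp only [tr2, Matrix.smul_apply, Matrix.map_apply, map_sum, smul_eq_mul, Finset.mul_sum]

theorem IsPairing.leg12_lift_opK (hP : IsPairing q μ R u w) :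
    leg12 (lift A (opK q μ R)) =
      (cup12 u).map (algebraMap ℂ A) * (cap12 w).map (algebraMap ℂ A) := by
  rw [leg12_lift, hP.leg12_opK_eq, Matrix.map_mul]

theorem IsPairing.cap12_map_mul_cup12_map (hP : IsPairing q μ R u w) :
    (cap12 w).map (algebraMap ℂ A) * (cup12 u).map (algebraMap ℂ A) =
      eta q μ • (1 : Matrix ι ι A) := by
  rw [← Matrix.map_mul, hP.cap12_mul_cup12, map_smul_one]

theorem IsPairing.leg12_mul_cup12 (hP : IsPairing q μ R u w) {g : A}
    {X : Matrix (ι × ι) (ι × ι) A} (h : X * lift A (opK q μ R) = g • lift A (opK q μ R)) :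
    leg12 X * (cup12 u).map (algebraMap ℂ A) = g • (cup12 u).map (algebraMap ℂ A) := by
  have h1 := congrArg (fun Z => (eta q μ)⁻¹ • (leg12 Z * (cup12 u).map (algebraMap ℂ A))) h
  simp only [leg12_mul, leg12_smul, hP.leg12_lift_opK, Matrix.mul_assoc, Matrix.smul_mul,
    hP.cap12_map_mul_cup12_map, Matrix.mul_smul, Matrix.mul_one] at h1
  rw [smul_smul, inv_mul_cancel₀ hP.eta_ne_zero, one_smul, smul_comm g, smul_smul,
    inv_mul_cancel₀ hP.eta_ne_zero, one_smul] at h1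
  exact h1

theorem IsPairing.cap12_mul_leg12 (hP : IsPairing q μ R u w) {g : A}
    {X : Matrix (ι × ι) (ι × ι) A} (h : lift A (opK q μ R) * X = g • lift A (opK q μ R)) :
    (cap12 w).map (algebraMap ℂ A) * leg12 X = g • (cap12 w).map (algebraMap ℂ A) := by
  have h1 := congrArg (fun Z => (eta q μ)⁻¹ • ((cap12 w).map (algebraMap ℂ A) * leg12 Z)) h
  simp only [leg12_mul, leg12_smul, hP.leg12_lift_opK, map_mul_smul] at h1
  simp only [← Matrix.mul_assoc, hP.cap12_map_mul_cup12_map, Matrix.smul_mul, Matrix.one_mul] at h1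
  rw [smul_smul, inv_mul_cancel₀ hP.eta_ne_zero, one_smul, smul_comm g, smul_smul,
    inv_mul_cancel₀ hP.eta_ne_zero, one_smul] at h1
  exact h1

/-- This is $M_{\overline2}M_{\overline3}=F_1F_2\,(M_{\overline1}M_{\overline2})\,(F_1F_2)^{-1}$,
with $f_i=F_i$, $g_i=F_i^{-1}$ and $m=M_1$. It needs only the braid relation and $[M_1,F_2]=0$. -/
theorem shift_copies {T : Type*} [Ring T] {f₁ f₂ g₁ g₂ m : T} (h₁ : f₁ * g₁ = 1) (h₁' : g₁ * f₁ = 1)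
    (h₂ : f₂ * g₂ = 1) (h₂' : g₂ * f₂ = 1) (hb : f₁ * f₂ * f₁ = f₂ * f₁ * f₂)
    (hm : m * f₂ = f₂ * m) :
    f₁ * m * g₁ * (f₂ * (f₁ * m * g₁) * g₂) * (f₁ * f₂) = f₁ * f₂ * (m * (f₁ * m * g₁)) := by
  have ha : g₁ * f₂ * f₁ = f₂ * f₁ * g₂ := by
    calc g₁ * f₂ * f₁ = g₁ * (f₂ * f₁ * f₂) * g₂ := by simp only [mul_assoc, h₂, mul_one]
      _ = (g₁ * f₁) * f₂ * f₁ * g₂ := by rw [← hb]; simp only [mul_assoc]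
      _ = f₂ * f₁ * g₂ := by rw [h₁', one_mul]
  have hc : g₁ * g₂ * (f₁ * f₂) = f₂ * g₁ := by
    calc g₁ * g₂ * (f₁ * f₂) = g₁ * g₂ * (f₁ * f₂ * f₁) * g₁ := by
          simp only [mul_assoc, h₁, mul_one]
      _ = g₁ * (g₂ * f₂) * f₁ * f₂ * g₁ := by rw [hb]; simp only [mul_assoc]
      _ = f₂ * g₁ := by rw [h₂', mul_one, h₁', one_mul]
  calc f₁ * m * g₁ * (f₂ * (f₁ * m * g₁) * g₂) * (f₁ * f₂)
      = f₁ * m * (g₁ * f₂ * f₁) * m * (g₁ * g₂ * (f₁ * f₂)) := by simp only [mul_assoc]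
    _ = f₁ * (m * f₂) * f₁ * g₂ * (m * f₂) * g₁ := by rw [ha, hc]; simp only [mul_assoc]
    _ = f₁ * f₂ * m * f₁ * (g₂ * f₂) * m * g₁ := by rw [hm]; simp only [mul_assoc]
    _ = f₁ * f₂ * (m * (f₁ * m * g₁)) := by rw [h₂']; simp only [mul_assoc, one_mul]

/-- The quantum matrix conjugates the contraction by `G`, in the normalization of
`IsPairing.exists_contraction_eq`. -/
theorem IsPairing.mul_contraction (hP : IsPairing q μ R u w) (hF : IsRMatrix F)
    (hRF : CompatiblePair R F) {g : A} (hM : relLeft R F M = relRight R F M)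
    (hg : leg1 M * copy2 F M * lift A (opK q μ R) = g • lift A (opK q μ R)) :
    M * (g • 1) = g • conjG q μ R F M := by
  obtain ⟨Y, hY, hYc, hYc', hG⟩ := hP.exists_cap_twist hF.1 hRF
  obtain ⟨H, hH, hHc⟩ := hP.exists_cup_twist hF.1 hRF
  have hg' := hg
  rw [mul_lift_opK_comm hM] at hg'
  have hcup := hP.leg12_mul_cup12 hg
  have hcap := hP.cap12_mul_leg12 hg'
  have hJ := hP.isUnit_cap12_mul_cup23
  have e1 : leg12 (leg1 M * copy2 F M) = leg12 (leg1 M) *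
      ((leg12 F).map (algebraMap ℂ A) * leg12 (leg1 M) * (leg12 F⁻¹).map (algebraMap ℂ A)) := by
    rw [leg12_mul, copy2, leg12_mul, leg12_mul, leg12_lift, leg12_lift]
  have hmap : ∀ {l m n : Type u} [Fintype m] {a : Matrix l m ℂ} {b : Matrix m n ℂ}
      {c : Matrix l n ℂ}, a * b = c → a.map (algebraMap ℂ A) * b.map (algebraMap ℂ A) =
        c.map (algebraMap ℂ A) := fun h => by rw [← Matrix.map_mul, h]
  have hshift := shift_copies (m := leg12 (leg1 M)) ((hmap (leg12_mul_inv_cancel hF.1)).trans map_one')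
    ((hmap (leg12_inv_mul_cancel hF.1)).trans map_one')
    ((hmap (leg23_mul_inv_cancel hF.1)).trans map_one')
    ((hmap (leg23_inv_mul_cancel hF.1)).trans map_one')
    (by simp only [← Matrix.map_mul, hF.2]) (leg12_leg1_mul_leg23 M F)
  rw [← e1] at hshift
  set X₁₂ := leg12 (leg1 M * copy2 F M) with hX₁₂
  set m := leg12 (leg1 M) with hm
  set f₁ := (leg12 F).map (algebraMap ℂ A)
  set f₂ := (leg23 F).map (algebraMap ℂ A)
  set g₁ := (leg12 F⁻¹).map (algebraMap ℂ A)
  set g₂ := (leg23 F⁻¹).map (algebraMap ℂ A)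
  set C₁₂ := (cap12 w).map (algebraMap ℂ A)
  set C₂₃ := (cap23 w).map (algebraMap ℂ A)
  set U₁₂ := (cup12 u).map (algebraMap ℂ A)
  set U₂₃ := (cup23 u).map (algebraMap ℂ A)
  have hH' : f₁ * f₂ * U₁₂ = U₂₃ * H.map (algebraMap ℂ A) := by
    simp only [f₁, f₂, U₁₂, U₂₃, ← Matrix.map_mul, hHc]
  have hYc₁ : C₁₂ * (f₂ * f₁) = Y.map (algebraMap ℂ A) * C₂₃ := by
    simp only [f₁, f₂, C₁₂, C₂₃, ← Matrix.map_mul, hYc]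
  have hYc₂ : C₂₃ * (g₁ * g₂) = Y⁻¹.map (algebraMap ℂ A) * C₁₂ := by
    simp only [g₁, g₂, C₁₂, C₂₃, ← Matrix.map_mul, hYc']
  have hdetH := (Matrix.isUnit_iff_isUnit_det _).1 hH
  -- The shifted product $M_{\overline2}M_{\overline3}$ acts on the shifted cup through the same
  -- $g$; the matrix $H$ drops out.
  have hcup' : f₁ * m * g₁ * (f₂ * (f₁ * m * g₁) * g₂) * U₂₃ = g • U₂₃ := by
    have h1 : f₁ * m * g₁ * (f₂ * (f₁ * m * g₁) * g₂) * (U₂₃ * H.map (algebraMap ℂ A)) =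
        g • (U₂₃ * H.map (algebraMap ℂ A)) := by
      rw [← hH', ← Matrix.mul_assoc, hshift, Matrix.mul_assoc, hcup]
      simp only [f₁, f₂, ← Matrix.map_mul]
      rw [map_mul_smul]
    have h2 := congrArg (· * H⁻¹.map (algebraMap ℂ A)) h1
    simp only [Matrix.smul_mul] at h2
    rw [Matrix.mul_assoc _ _ (H⁻¹.map (algebraMap ℂ A)),
      Matrix.mul_assoc _ _ (H⁻¹.map (algebraMap ℂ A)), ← Matrix.map_mul,
      Matrix.mul_nonsing_inv _ hdetH, map_one', Matrix.mul_one] at h2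
    exact h2
  -- Pulling the cap through the crossings turns $M_{\overline3}$ into $M$ conjugated by $Y$.
  have h3 : C₁₂ * (f₂ * (f₁ * m * g₁) * g₂) * U₂₃ =
      Y.map (algebraMap ℂ A) * (M * (Y⁻¹.map (algebraMap ℂ A) * (C₁₂ * U₂₃))) := by
    calc _ = C₁₂ * (f₂ * f₁) * m * (g₁ * g₂) * U₂₃ := by simp only [Matrix.mul_assoc]
      _ = Y.map (algebraMap ℂ A) * (C₂₃ * m) * (g₁ * g₂) * U₂₃ := by
          rw [hYc₁]; simp only [Matrix.mul_assoc]
      _ = Y.map (algebraMap ℂ A) * (M * (C₂₃ * (g₁ * g₂)) * U₂₃) := by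
          rw [hm, cap23_mul_leg12_leg1]; simp only [C₂₃, Matrix.mul_assoc]
      _ = _ := by rw [hYc₂]; simp only [Matrix.mul_assoc]
  -- Two evaluations of $C_{12}M_{\overline1}M_{\overline2}M_{\overline3}U_{23}$: the cap absorbs
  -- the first two copies, or the cup absorbs the last two.
  have h4 : g • (Y.map (algebraMap ℂ A) * (M * (Y⁻¹.map (algebraMap ℂ A) * (C₁₂ * U₂₃)))) =
      (C₁₂ * U₂₃) * (M * (g • 1)) := by
    calc _ = C₁₂ * X₁₂ * (f₂ * (f₁ * m * g₁) * g₂) * U₂₃ := by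
          rw [hcap, ← h3]; simp only [Matrix.smul_mul]
      _ = C₁₂ * m * (f₁ * m * g₁ * (f₂ * (f₁ * m * g₁) * g₂) * U₂₃) := by
          rw [e1]; simp only [Matrix.mul_assoc]
      _ = C₁₂ * (m * U₂₃) * (g • 1) := by
          rw [hcup', smul_map_eq]; simp only [U₂₃, Matrix.mul_assoc]
      _ = _ := by rw [hm, leg12_leg1_mul_cup23]; simp only [U₂₃, Matrix.mul_assoc]
  have hdetJ := (Matrix.isUnit_iff_isUnit_det _).1 hJ
  have h5 : C₁₂ * U₂₃ = (cap12 w * cup23 u).map (algebraMap ℂ A) := by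
    rw [Matrix.map_mul]
  have h7 : (cap12 w * cup23 u)⁻¹.map (algebraMap ℂ A) *
      (cap12 w * cup23 u).map (algebraMap ℂ A) = 1 := by
    rw [← Matrix.map_mul, Matrix.nonsing_inv_mul _ hdetJ, map_one']
  rw [h5] at h4
  have h6 := congrArg ((cap12 w * cup23 u)⁻¹.map (algebraMap ℂ A) * ·) h4
  simp only [map_mul_smul] at h6
  rw [← Matrix.mul_assoc _ ((cap12 w * cup23 u).map (algebraMap ℂ A)), h7, Matrix.one_mul] at h6
  rw [← h6, conjG, hG, Matrix.mul_inv_rev,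
    Matrix.nonsing_inv_nonsing_inv _ ((Matrix.isUnit_iff_isUnit_det _).1 hY), lift, lift]
  simp only [Matrix.map_mul, Matrix.mul_assoc]

/-- `M` is invertible from the left up to the contraction. -/
theorem IsPairing.exists_mul_eq (hP : IsPairing q μ R u w) (hF : IsRMatrix F)
    (hRF : CompatiblePair R F) {g : A} (hM : relLeft R F M = relRight R F M)
    (hg : leg1 M * copy2 F M * lift A (opK q μ R) = g • lift A (opK q μ R)) :
    ∃ (B : Matrix ι ι A) (V : Matrix ι ι ℂ), IsUnit V ∧
      B * M = g • V.map (algebraMap ℂ A) := by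
  obtain ⟨Y, -, hYc, -, -⟩ := hP.exists_cap_twist hF.1 hRF
  have hV := isUnit_compOp hP.isUnit_cap hF hYc
  rw [mul_lift_opK_comm hM] at hg
  have h1 : compOp (w.map (algebraMap ℂ A)) (leg1 M * copy2 F M) =
      g • w.map (algebraMap ℂ A) := by
    refine cap12_injective ?_
    rw [cap12_compOp, cap12_map, hP.cap12_mul_leg12 hg, ← cap12_map]
    ext i j
    simp only [cap12, Matrix.smul_apply]
    split_ifs <;> simp
  -- Multiplying by $F$ removes the trailing $F^{-1}$, so a bare $M_1$ stands at the right end and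
  -- everything before it can be collected into $B$.
  have h2 : leg1 M * copy2 F M * lift A F = leg1 M * lift A F * leg1 M := by
    rw [copy2, mul_assoc, mul_assoc, lift_eq_mapMatrix F⁻¹, lift_eq_mapMatrix F, ← map_mul,
      Matrix.nonsing_inv_mul _ ((Matrix.isUnit_iff_isUnit_det _).1 hF.1), map_one, mul_one,
      mul_assoc]
  have h3 := congrArg (compOp · (lift A F)) h1
  simp only [compOp_compOp, h2] at h3
  rw [← compOp_compOp, compOp_leg1_eq] at h3
  refine ⟨(compOp (w.map (algebraMap ℂ A)) (leg1 M * lift A F)).transpose,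
    (compOp w F).transpose, (Matrix.isUnit_transpose _).2 hV, ?_⟩
  rw [← Matrix.transpose_transpose (_ * M), h3, Matrix.transpose_map, ← compOp_map]
  ext i j
  simp [compOp, lift, Finset.mul_sum, mul_assoc]

end OverAlgebra

/-! ### The extended algebra: universal property, consistency and $M^{-1}$. -/

section Extension

variable {ι : Type u} [Fintype ι] [DecidableEq ι] {q μ : ℂ}
  {R F : Matrix (ι × ι) (ι × ι) ℂ} {u w : Matrix ι ι ℂ}

theorem contraction_map {A B : Type*} [Semiring A] [Algebra ℂ A] [Semiring B] [Algebra ℂ B]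
    (f : A →ₐ[ℂ] B) (q μ : ℂ) (R F : Matrix (ι × ι) (ι × ι) ℂ) (M : Matrix ι ι A) :
    f (contraction q μ R F M) = contraction q μ R F (M.map f) := by
  have h : ∀ X : Matrix (ι × ι) (ι × ι) A, f (Matrix.trace X) = Matrix.trace (X.map f) := by
    intro X
    simp [Matrix.trace]
  rw [contraction, contraction, map_smul, rTr12, rTr12, h]
  simp only [Matrix.map_mul, lift_map, leg1_map, copy2_map]

theorem conjG_map {A B : Type*} [Semiring A] [Algebra ℂ A] [Semiring B] [Algebra ℂ B]
    (f : A →ₐ[ℂ] B) (q μ : ℂ) (R F : Matrix (ι × ι) (ι × ι) ℂ) (M : Matrix ι ι A) :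
    (conjG q μ R F M).map f = conjG q μ R F (M.map f) := by
  simp only [conjG, Matrix.map_mul, lift_map]

theorem genM_rel (R F : Matrix (ι × ι) (ι × ι) ℂ) :
    relLeft R F (genM R F) = relRight R F (genM R F) := by
  rw [genM, ← relLeft_map, ← relRight_map]
  ext i j
  exact RingQuot.mkAlgHom_rel ℂ (QMRel.rmm i j)

theorem toExt_genM (q μ : ℂ) (R F : Matrix (ι × ι) (ι × ι) ℂ) :
    (genM R F).map (toExt q μ R F) = extM q μ R F := by
  ext a b
  simp [genM, toExt, freeM]

theorem toExt_contraction (q μ : ℂ) (R F : Matrix (ι × ι) (ι × ι) ℂ) :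
    toExt q μ R F (contraction q μ R F (genM R F)) = contraction q μ R F (extM q μ R F) := by
  rw [contraction_map, toExt_genM]

theorem contraction_mul_extInv (q μ : ℂ) (R F : Matrix (ι × ι) (ι × ι) ℂ) :
    contraction q μ R F (extM q μ R F) * extInv q μ R F = 1 := by
  rw [extM, ← contraction_map, extInv, ← map_mul, ← map_one (RingQuot.mkAlgHom ℂ _)]
  exact RingQuot.mkAlgHom_rel ℂ ExtRel.mul_inv

theorem extInv_mul_contraction (q μ : ℂ) (R F : Matrix (ι × ι) (ι × ι) ℂ) :
    extInv q μ R F * contraction q μ R F (extM q μ R F) = 1 := by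
  rw [extM, ← contraction_map, extInv, ← map_mul, ← map_one (RingQuot.mkAlgHom ℂ _)]
  exact RingQuot.mkAlgHom_rel ℂ ExtRel.inv_mul

/-- A quantum matrix over `B` with invertible contraction, and the expected commutation relation,
defines a homomorphism from the extended algebra. -/
theorem exists_extLift {B : Type*} [Semiring B] [Algebra ℂ B] (N : Matrix ι ι B) (b : B)
    (hN : relLeft R F N = relRight R F N) (hb : b * contraction q μ R F N = 1)
    (hb' : contraction q μ R F N * b = 1)
    (hc : ∀ i j, b * N i j = conjG q μ R F N i j * b) :
    ∃ h : ExtAlgebra q μ R F →ₐ[ℂ] B, (extM q μ R F).map h = N ∧ h (extInv q μ R F) = b := by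
  let φ : FreeAlgebra ℂ (Option (ι × ι)) →ₐ[ℂ] B :=
    FreeAlgebra.lift ℂ fun o => o.elim b fun p => N p.1 p.2
  have hφN : (freeExtM ι).map φ = N := by
    ext i j
    simp [φ, freeExtM]
  have hφb : φ (freeExtInv ι) = b := by simp [φ, freeExtInv]
  have hφ : ∀ ⦃x y⦄, ExtRel q μ R F x y → φ x = φ y := by
    intro x y hxy
    cases hxy with
    | rmm i j =>
      have hl := congrFun (congrFun (relLeft_map φ R F (freeExtM ι)) i) j
      have hr := congrFun (congrFun (relRight_map φ R F (freeExtM ι)) i) j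
      rw [hφN] at hl hr
      exact hl.trans ((congrFun (congrFun hN i) j).trans hr.symm)
    | inv_mul => rw [map_mul, contraction_map, hφN, hφb, hb, map_one]
    | mul_inv => rw [map_mul, contraction_map, hφN, hφb, hb', map_one]
    | comm i j =>
      have h1 := congrFun (congrFun (conjG_map φ q μ R F (freeExtM ι)) i) j
      have h2 : φ (freeExtM ι i j) = N i j := congrFun (congrFun hφN i) j
      rw [hφN, Matrix.map_apply] at h1
      rw [map_mul, map_mul, h1, hφb, h2, hc]
  refine ⟨RingQuot.liftAlgHom ℂ ⟨φ, hφ⟩, ?_, ?_⟩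
  · rw [← hφN]
    ext i j
    simp [extM]
  · rw [extInv, RingQuot.liftAlgHom_mkAlgHom_apply, hφb]

theorem QMAlgebra.algHom_ext {B : Type*} [Semiring B] [Algebra ℂ B] {f g : QMAlgebra R F →ₐ[ℂ] B}
    (h : (genM R F).map f = (genM R F).map g) : f = g := by
  refine RingQuot.ringQuot_ext' ℂ _ _ (FreeAlgebra.hom_ext (funext fun p => ?_))
  exact congrFun (congrFun h p.1) p.2

theorem ExtAlgebra.algHom_ext {B : Type*} [Semiring B] [Algebra ℂ B]
    {f g : ExtAlgebra q μ R F →ₐ[ℂ] B} (h : (extM q μ R F).map f = (extM q μ R F).map g)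
    (h' : f (extInv q μ R F) = g (extInv q μ R F)) : f = g := by
  refine RingQuot.ringQuot_ext' ℂ _ _ (FreeAlgebra.hom_ext (funext fun o => ?_))
  cases o with
  | none => exact h'
  | some p => exact congrFun (congrFun h p.1) p.2

theorem IsPairing.isUnit_opG (hP : IsPairing q μ R u w) (hF : IsRMatrix F)
    (hRF : CompatiblePair R F) : IsUnit (opG q μ R F) := by
  obtain ⟨Y, hY, -, -, hG⟩ := hP.exists_cap_twist hF.1 hRF
  rw [hG]
  exact ((Matrix.isUnit_nonsing_inv_iff).2 hY).mul hP.isUnit_cap12_mul_cup23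

/-- `M g = g (G⁻¹ M G)`. -/
theorem IsPairing.apply_mul_contraction (hP : IsPairing q μ R u w) (hF : IsRMatrix F)
    (hRF : CompatiblePair R F) {A : Type*} [Ring A] [Algebra ℂ A] {M : Matrix ι ι A}
    (hM : relLeft R F M = relRight R F M) (a b : ι) :
    M a b * contraction q μ R F M = contraction q μ R F M * conjG q μ R F M a b := by
  obtain ⟨g, hc, hg⟩ := hP.exists_contraction_eq hM
  have h := congrFun (congrFun (hP.mul_contraction hF hRF hM hg) a) b
  rw [hc, mul_smul_comm, smul_mul_assoc]
  congr 1
  simpa [Matrix.mul_apply, Matrix.one_apply] using h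

/-- The unit matrix is a quantum matrix whose contraction is `μ²`. -/
theorem IsPairing.nontrivial_extAlgebra (hP : IsPairing q μ R u w) (hμ : μ ≠ 0)
    (hK : opK q μ R ≠ 0) (hF : IsRMatrix F) (hRF : CompatiblePair R F) :
    Nontrivial (ExtAlgebra q μ R F) := by
  have hl : ∀ {κ : Type u} (X : Matrix κ κ ℂ), lift ℂ X = X := fun X => by
    ext i j; simp [lift]
  have h1 : leg1 (1 : Matrix ι ι ℂ) = 1 := by
    ext ⟨a, b⟩ ⟨c, d⟩
    simp only [leg1, Matrix.one_apply, Prod.mk.injEq]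
    split_ifs <;> simp_all
  have h2 : copy2 F (1 : Matrix ι ι ℂ) = 1 := by
    rw [copy2, hl, hl, h1, mul_one,
      Matrix.mul_nonsing_inv _ ((Matrix.isUnit_iff_isUnit_det _).1 hF.1)]
  have hM : relLeft R F (1 : Matrix ι ι ℂ) = relRight R F 1 := by
    rw [relLeft, relRight, h1, h2, hl]
    simp
  obtain ⟨g, hc, hg⟩ := hP.exists_contraction_eq hM
  rw [h1, h2, hl, one_mul, one_mul] at hg
  have hg1 : g = 1 := by
    refine smul_left_injective ℂ hK ?_
    simpa using hg.symm
  rw [hg1, smul_eq_mul, mul_one] at hc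
  have hG := (Matrix.isUnit_iff_isUnit_det _).1 (hP.isUnit_opG hF hRF)
  obtain ⟨h, -⟩ := exists_extLift (q := q) (μ := μ) (R := R) (F := F) (1 : Matrix ι ι ℂ)
    (μ ^ 2)⁻¹ hM (by rw [hc, inv_mul_cancel₀ (pow_ne_zero 2 hμ)])
    (by rw [hc, mul_inv_cancel₀ (pow_ne_zero 2 hμ)])
    (fun i j => by rw [conjG, hl, hl, mul_one, Matrix.nonsing_inv_mul _ hG, mul_comm])
  exact h.toRingHom.domain_nontrivial

theorem IsPairing.existsUnique_extLift (hP : IsPairing q μ R u w) (hF : IsRMatrix F)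
    (hRF : CompatiblePair R F) {B : Type*} [Ring B] [Algebra ℂ B] (f : QMAlgebra R F →ₐ[ℂ] B)
    (hf : IsUnit (f (contraction q μ R F (genM R F)))) :
    ∃! h : ExtAlgebra q μ R F →ₐ[ℂ] B, h.comp (toExt q μ R F) = f := by
  have hN : relLeft R F ((genM R F).map f) = relRight R F ((genM R F).map f) := by
    rw [← relLeft_map, ← relRight_map, genM_rel]
  rw [contraction_map] at hf
  obtain ⟨c, hc⟩ := hf
  obtain ⟨h, hM, hi⟩ := exists_extLift (q := q) (μ := μ) ((genM R F).map f) (↑c⁻¹ : B) hN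
    -- The last relation required of the inverse is $Mg=g\,(G^{-1}MG)$ multiplied by $g^{-1}$ on
    -- both sides, so it holds in any target where $g$ becomes invertible.
    (by rw [← hc, Units.inv_mul]) (by rw [← hc, Units.mul_inv]) (fun i j => by
      have h1 := hP.apply_mul_contraction hF hRF hN i j
      rw [← hc] at h1
      rw [Units.inv_mul_eq_iff_eq_mul, ← mul_assoc, ← h1, mul_assoc, Units.mul_inv, mul_one])
  refine ⟨h, QMAlgebra.algHom_ext ?_, fun h' hh' => ExtAlgebra.algHom_ext ?_ ?_⟩
  · rw [← hM, ← toExt_genM]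
    rfl
  · rw [hM, ← toExt_genM, ← hh']
    rfl
  -- No choice is left for the image of $g^{-1}$, since inverses are unique.
  · have h1 : h' (contraction q μ R F (extM q μ R F)) = c := by
      rw [hc, ← toExt_contraction, ← hh', ← contraction_map]
      rfl
    have h2 := congrArg h' (contraction_mul_extInv q μ R F)
    rw [map_mul, map_one, h1] at h2
    rw [hi]
    exact (Units.inv_eq_of_mul_eq_one_right h2).symm

theorem IsPairing.extM_mul_extMInv (hP : IsPairing q μ R u w) :
    extM q μ R F * extMInv q μ R F = 1 := by
  obtain ⟨g, hc, hg⟩ := hP.exists_contraction_eq (extM_rel q μ R F)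
  have h := hP.mul_xi hg
  have h1 := contraction_mul_extInv q μ R F
  rw [hc] at h1
  ext a b
  calc (extM q μ R F * extMInv q μ R F) a b
      = μ • ((extM q μ R F * xi q μ R F (extM q μ R F)) a b * extInv q μ R F) := by
        simp only [Matrix.mul_apply, extMInv, mul_smul_comm, Finset.sum_mul, Finset.smul_sum,
          mul_assoc]
    _ = (1 : Matrix ι ι (ExtAlgebra q μ R F)) a b := by
        rw [h]
        by_cases hab : a = b
        · subst hab
          simp only [Matrix.smul_apply, Matrix.one_apply_eq, smul_eq_mul, mul_smul_comm,
            mul_one, smul_mul_assoc, smul_smul]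
          rw [← pow_two, ← smul_mul_assoc, h1]
        · simp [Matrix.one_apply_ne hab]

theorem IsPairing.extMInv_mul_extM (hP : IsPairing q μ R u w) (hF : IsRMatrix F)
    (hRF : CompatiblePair R F) : extMInv q μ R F * extM q μ R F = 1 := by
  obtain ⟨g, hc, hg⟩ := hP.exists_contraction_eq (extM_rel q μ R F)
  obtain ⟨B, V, hV, hB⟩ := hP.exists_mul_eq hF hRF (extM_rel q μ R F) hg
  have h1 := extInv_mul_contraction q μ R F
  rw [hc, mul_smul_comm] at h1
  -- The relation $BM=gV$ becomes a left inverse; $\mu^2$ compensates for `contraction` being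
  -- $\mu^2$ times this $g$.
  have hL : (V⁻¹.map (algebraMap ℂ (ExtAlgebra q μ R F)) *
      ((μ ^ 2 • extInv q μ R F) • B)) * extM q μ R F = 1 := by
    rw [Matrix.mul_assoc, Matrix.smul_mul, hB, smul_smul, smul_mul_assoc, h1, one_smul,
      ← Matrix.map_mul, Matrix.nonsing_inv_mul _ ((Matrix.isUnit_iff_isUnit_det _).1 hV), map_one']
  rw [← left_inv_eq_right_inv hL hP.extM_mul_extMInv, hL]

end Extension

end QuantumMatrix

theorem mainTheorem8 {ι : Type u} [Fintype ι] [DecidableEq ι] (q μ : ℂ)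
    (R F : Matrix (ι × ι) (ι × ι) ℂ)
    (hR : QuantumMatrix.IsBMWType q μ R) (hRs : QuantumMatrix.StrictSkewInvertible R)
    (hF : QuantumMatrix.IsRMatrix F) (hFs : QuantumMatrix.StrictSkewInvertible F)
    (hRF : QuantumMatrix.CompatiblePair R F) :
    -- `G` is invertible, and `M g = g (G⁻¹ M G)` already holds in `M(R, F)`
    IsUnit (QuantumMatrix.opG q μ R F) ∧
    (∀ a b : ι,
      QuantumMatrix.genM R F a b *
          QuantumMatrix.contraction q μ R F (QuantumMatrix.genM R F) =
        QuantumMatrix.contraction q μ R F (QuantumMatrix.genM R F) *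
          QuantumMatrix.conjG q μ R F (QuantumMatrix.genM R F) a b) ∧
    -- consistency: the extended algebra is nonzero, and it is the universal algebra
    -- under `M(R, F)` in which `g` is invertible
    Nontrivial (QuantumMatrix.ExtAlgebra q μ R F) ∧
    QuantumMatrix.toExt q μ R F
        (QuantumMatrix.contraction q μ R F (QuantumMatrix.genM R F)) *
      QuantumMatrix.extInv q μ R F = 1 ∧
    QuantumMatrix.extInv q μ R F *
      QuantumMatrix.toExt q μ R F
        (QuantumMatrix.contraction q μ R F (QuantumMatrix.genM R F)) = 1 ∧
    (∀ (B : Type v) [Ring B] [Algebra ℂ B] (f : QuantumMatrix.QMAlgebra R F →ₐ[ℂ] B),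
      IsUnit (f (QuantumMatrix.contraction q μ R F (QuantumMatrix.genM R F))) →
        ∃! h : QuantumMatrix.ExtAlgebra q μ R F →ₐ[ℂ] B,
          h.comp (QuantumMatrix.toExt q μ R F) = f) ∧
    -- `M⁻¹ := μ ξ(M) g⁻¹` is a two-sided inverse of `M` over the extended algebra
    QuantumMatrix.extM q μ R F * QuantumMatrix.extMInv q μ R F = 1 ∧
    QuantumMatrix.extMInv q μ R F * QuantumMatrix.extM q μ R F = 1 := by
  obtain ⟨u, w, hP⟩ := hR.exists_isPairing hRs.1
  refine ⟨hP.isUnit_opG hF hRF,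
    fun a b => hP.apply_mul_contraction hF hRF (QuantumMatrix.genM_rel R F) a b,
    hP.nontrivial_extAlgebra hR.mu_ne_zero hR.opK_ne_zero hF hRF, ?_, ?_,
    fun B _ _ f hf => hP.existsUnique_extLift hF hRF f hf,
    hP.extM_mul_extMInv, hP.extMInv_mul_extM hF hRF⟩
  · rw [QuantumMatrix.toExt_contraction, QuantumMatrix.contraction_mul_extInv]
  · rw [QuantumMatrix.toExt_contraction, QuantumMatrix.extInv_mul_contraction]
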